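/- All graphs are finite. For a simple graph $Q$ and a vertex $v$, let $d(v)$ be the degree of $v$ and let $\omega(v)$ be the largest size of a clique containing $v$. For $r\in\mathbb{N}\cup\{\infty\}$ let $\mathcal{C}_r(Q)$ be the family of all $X\subseteq V(Q)$ such that either $X$ is an inclusion-maximal clique with $|X|<r$, or $X$ is a clique with $|X|=r$. Put \[\gamma_r(Q)=\max_{X\in\mathcal{C}_r(Q)}\frac{1}{|X|}\sum_{v\in X}\frac{d(v)+\omega(v)+1}{2},\qquad \tilde\gamma_r(Q)=\max_{H\subseteq Q}\gamma_r(H),\] where $H$ ranges over all subgraphs of $Q$, and where degrees, cliques and clique numbers in $\gamma_r(H)$ are taken in $H$. \textbf{Theorem.} If $Q$ is a line graph, that is, the line graph of a multigraph without loops (the vertices of $Q$ are the edges of the multigraph, two distinct ones being adjacent if they share an endpoint), then \[\chi(Q)\le\lceil\tilde\gamma_3(Q)\rceil.\] -/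

import Mathlib

noncomputable section

namespace LocalReed

/-- The line graph of a multigraph `G`: the vertices are the edges of `G`, and two distinct edges
are adjacent when they have a common end (in particular, parallel edges are adjacent). -/
def lineGraph {α β : Type*} (G : Graph α β) : SimpleGraph G.edgeSet where
  Adj e f := e ≠ f ∧ ∃ x, G.Inc e x ∧ G.Inc f x
  symm := ⟨fun _ _ ⟨hne, x, he, hf⟩ => ⟨hne.symm, x, hf, he⟩⟩
  loopless := ⟨fun _ h => h.1 rfl⟩

/-- `Q` is a line graph: it is isomorphic to the line graph of a finite loopless multigraph. -/
def IsLineGraph.{u} {V : Type u} (Q : SimpleGraph V) : Prop :=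
  ∃ (α β : Type u) (G : Graph α β), G.Loopless ∧ G.vertexSet.Finite ∧ G.edgeSet.Finite ∧
    Nonempty (Q ≃g lineGraph G)

section Gamma

variable {V : Type*}

/-- The degree `d(v)` of a vertex. -/
def deg (Q : SimpleGraph V) (v : V) : ℕ := (Q.neighborSet v).ncard

/-- The number `ω(v)`: the largest size of a clique containing `v`. -/
def localCliqueNum (Q : SimpleGraph V) (v : V) : ℕ :=
  sSup {n : ℕ | ∃ X : Finset V, Q.IsClique (X : Set V) ∧ v ∈ X ∧ X.card = n}

/-- The set `C_r(Q)`: the maximal cliques of size less than `r`, and all cliques of size `r`. -/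
def cliqueFamily (r : ℕ∞) (Q : SimpleGraph V) : Set (Finset V) :=
  {X | (Maximal Q.IsClique (X : Set V) ∧ (X.card : ℕ∞) < r) ∨
    (Q.IsClique (X : Set V) ∧ (X.card : ℕ∞) = r)}

/-- The average over `X` of `(d(v) + ω(v) + 1) / 2`. -/
def cliqueAverage (Q : SimpleGraph V) (X : Finset V) : ℝ :=
  (1 / (X.card : ℝ)) * ∑ v ∈ X, ((deg Q v : ℝ) + (localCliqueNum Q v : ℝ) + 1) / 2

/-- `γ_r(Q)`, the maximum of the averages over the members of `C_r(Q)`. -/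
def gamma (r : ℕ∞) (Q : SimpleGraph V) : ℝ :=
  sSup (cliqueAverage Q '' cliqueFamily r Q)

/-- The maximum of `γ_r(H)` over all subgraphs `H` of `Q`. -/
def gammaTilde (r : ℕ∞) (Q : SimpleGraph V) : ℝ :=
  sSup (Set.range fun H : Q.Subgraph => gamma r H.coe)

/-! On a finite graph the suprema above are maxima. -/

theorem isGreatest_localCliqueNum [Finite V] (Q : SimpleGraph V) (v : V) :
    IsGreatest {n : ℕ | ∃ X : Finset V, Q.IsClique (X : Set V) ∧ v ∈ X ∧ X.card = n}
      (localCliqueNum Q v) := by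
  have hne : {n : ℕ | ∃ X : Finset V, Q.IsClique (X : Set V) ∧ v ∈ X ∧ X.card = n}.Nonempty :=
    ⟨1, {v}, by simp, by simp, by simp⟩
  have hfin : {n : ℕ | ∃ X : Finset V, Q.IsClique (X : Set V) ∧ v ∈ X ∧ X.card = n}.Finite :=
    (Set.finite_range (Finset.card : Finset V → ℕ)).subset fun _ ⟨X, _, _, h⟩ => ⟨X, h⟩
  exact ⟨Nat.sSup_mem hne hfin.bddAbove, fun _ h => le_csSup hfin.bddAbove h⟩

theorem cliqueFamily_nonempty [Finite V] (r : ℕ∞) (Q : SimpleGraph V) :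
    (cliqueFamily r Q).Nonempty := by
  obtain ⟨M, hM⟩ := Q.maximumClique_exists
  have hmax := hM.isMaximalClique
  by_cases h : (M.card : ℕ∞) < r
  · exact ⟨M, Or.inl ⟨hmax, h⟩⟩
  · have hr : r ≤ M.card := not_lt.1 h
    lift r to ℕ using (lt_of_le_of_lt hr (ENat.natCast_lt_top _)).ne
    obtain ⟨X, hX, hc⟩ := Finset.exists_subset_card_eq (Nat.cast_le.1 hr)
    exact ⟨X, Or.inr ⟨hmax.prop.subset (Finset.coe_subset.2 hX), by rw [hc]⟩⟩

theorem isGreatest_gamma [Finite V] (r : ℕ∞) (Q : SimpleGraph V) :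
    IsGreatest (cliqueAverage Q '' cliqueFamily r Q) (gamma r Q) := by
  have hfin : (cliqueAverage Q '' cliqueFamily r Q).Finite := (Set.toFinite _).image _
  exact ⟨((cliqueFamily_nonempty r Q).image _).csSup_mem hfin,
    fun _ h => le_csSup hfin.bddAbove h⟩

theorem isGreatest_gammaTilde [Finite V] (r : ℕ∞) (Q : SimpleGraph V) :
    IsGreatest (Set.range fun H : Q.Subgraph => gamma r H.coe) (gammaTilde r Q) := by
  have : Finite Q.Subgraph := by
    refine Finite.of_injective
      (fun H : Q.Subgraph => ((H.verts, fun a b => H.Adj a b) : Set V × (V → V → Prop))) ?_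
    intro H K h
    simp only [Prod.mk.injEq] at h
    exact SimpleGraph.Subgraph.ext h.1 h.2
  have hfin := Set.finite_range fun H : Q.Subgraph => gamma r H.coe
  exact ⟨(Set.range_nonempty _).csSup_mem hfin, fun _ h => le_csSup hfin.bddAbove h⟩

end Gamma

end LocalReed

end

/-! Put `k = ⌈γ̃₃(Q)⌉` and suppose that `Q` is not `k`-colourable. A minimal non-`k`-colourable
induced subgraph is the line graph of an edge-critical multigraph. In it any three pairwise meeting
edges satisfy `∑ (D + W) ≤ 6k`, where `D` is the closed degree and `W` the local clique number. For
an edge `uv` with multiplicity `μ(uv)`, `D ≥ d(u) + d(v) - μ(uv)`, and `W` is at least `d(u)`,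
`d(v)` and the number of edges inside any triangle containing `uv`.

Let `x` have maximum degree `Δ`. Criticality and these bounds give `Δ < k` (`degree_lt_of_max`), so
every vertex always misses a colour. Then the vertices of a Vizing fan at `x`, or of a Kierstead
path, miss pairwise disjoint sets of colours, which bounds their degree sum from below, while the
averages bound it from above.

This clash rules out fans with three leaves (`not_three_fan`), so an uncoloured edge `xy` and a
suitable `xz` form a fan that cannot be extended. A Kierstead path through `y, x, z` then shows that
each colour missing at one vertex of `T = {x, y, z}` lies on an edge joining the other two
(`exists_inner_edge`). The edges inside `T` form a clique of the line graph; if they carried all `k`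
colours, the averages would be too large, so some colour `b` is only on edges not inside `T`. Kempe
changes away from the inner edges make `b` missing at one vertex of `T` while it still leaves `T` at
the other two (`exists_recolouring`), contradicting the previous property. -/

namespace LocalReed

/-! ### Kempe chains and Kempe changes -/

section Kempe

/-- In a graph of maximum degree two, no component has three vertices of degree at most one. -/
theorem not_reachable_of_degree_le_one {N : Type*} [Finite N] (G : SimpleGraph N)
    (h2 : ∀ v, (G.neighborSet v).ncard ≤ 2) {a b c : N} (hab : a ≠ b) (hac : a ≠ c) (hbc : b ≠ c)
    (ha : (G.neighborSet a).ncard ≤ 1) (hb : (G.neighborSet b).ncard ≤ 1)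
    (hc : (G.neighborSet c).ncard ≤ 1) (rab : G.Reachable a b) (rac : G.Reachable a c) : False := by
  classical
  have := Fintype.ofFinite N
  set K := G.connectedComponentMk a with hK
  have hconn : K.toSimpleGraph.Connected := K.connected_toSimpleGraph
  -- A component with `n` vertices has at least `n - 1` edges, so degree sum at least `2n - 2`;
  -- three vertices of degree at most one would leave at most `2n - 3`.
  have h1 := hconn.card_vert_le_card_edgeSet_add_one
  have hs := K.toSimpleGraph.sum_degrees_eq_twice_card_edges
  have hdeg : ∀ v : K, K.toSimpleGraph.degree v ≤ (G.neighborSet v).ncard := by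
    intro v
    rw [← SimpleGraph.card_neighborSet_eq_degree, ← Nat.card_eq_fintype_card, Nat.card_coe_set_eq]
    refine Set.ncard_le_ncard_of_injOn (fun w => (w : N)) ?_ ?_ (Set.toFinite _)
    · intro w hw
      exact hw
    · intro w _ w' _ h
      exact Subtype.ext h
  have mb : b ∈ K.supp := by
    rw [SimpleGraph.ConnectedComponent.mem_supp_iff, hK, SimpleGraph.ConnectedComponent.eq]
    exact rab.symm
  have mc : c ∈ K.supp := by
    rw [SimpleGraph.ConnectedComponent.mem_supp_iff, hK, SimpleGraph.ConnectedComponent.eq]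
    exact rac.symm
  have ma : a ∈ K.supp := by
    rw [SimpleGraph.ConnectedComponent.mem_supp_iff, hK]
  let s : Finset K := {⟨a, ma⟩, ⟨b, mb⟩, ⟨c, mc⟩}
  have hcard : s.card = 3 := by
    rw [Finset.card_eq_three]
    exact ⟨_, _, _, by simpa using hab, by simpa using hac, by simpa using hbc, rfl⟩
  have hle : ∑ v : K, (K.toSimpleGraph.degree v + if v ∈ s then 1 else 0) ≤ ∑ v : K, 2 := by
    refine Finset.sum_le_sum fun v _ => ?_
    split_ifs with hv
    · have : (G.neighborSet v).ncard ≤ 1 := by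
        simp only [s, Finset.mem_insert, Finset.mem_singleton] at hv
        rcases hv with rfl | rfl | rfl <;> assumption
      have := hdeg v
      omega
    · have := hdeg v
      have := h2 v
      omega
  rw [Finset.sum_add_distrib, hs, Finset.sum_ite_mem, Finset.univ_inter] at hle
  simp only [Finset.sum_const, smul_eq_mul, mul_one, hcard, Finset.card_univ] at hle
  rw [Nat.card_eq_fintype_card, Nat.card_eq_fintype_card, ← SimpleGraph.edgeFinset_card] at h1
  have e1 : Fintype.card ↥K = Fintype.card ↑K.supp := Fintype.card_congr (Equiv.refl _)
  omega

variable {N E C : Type*} (ends : E → Sym2 N)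

/-- `φ` is a proper edge colouring of the multigraph without the edge `e`. -/
def IsProperOff (e : E) (φ : E → C) : Prop :=
  ∀ f g, f ≠ e → g ≠ e → f ≠ g → ∀ v, v ∈ ends f → v ∈ ends g → φ f ≠ φ g

/-- The colour `c` is missing at the vertex `v`, when the edge `e` is left uncoloured. -/
def Missing (e : E) (φ : E → C) (v : N) (c : C) : Prop :=
  ∀ f, f ≠ e → v ∈ ends f → φ f ≠ c

/-- The graph of the edges satisfying `P` and coloured `a` or `b`. -/
def kempeGraph (P : E → Prop) (φ : E → C) (a b : C) : SimpleGraph N where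
  Adj u v := u ≠ v ∧ ∃ f, P f ∧ ends f = s(u, v) ∧ (φ f = a ∨ φ f = b)
  symm := ⟨fun _ _ ⟨h, f, hP, hf, hc⟩ => ⟨h.symm, f, hP, hf.trans Sym2.eq_swap, hc⟩⟩
  loopless := ⟨fun _ h => h.1 rfl⟩

/-- No edge coloured `a` or `b` leaves the vertex set `S`. -/
def KempeClosed (e : E) (φ : E → C) (a b : C) (S : Set N) : Prop :=
  ∀ f, f ≠ e → (φ f = a ∨ φ f = b) → ∀ u ∈ ends f, ∀ v ∈ ends f, u ∈ S → v ∈ S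

open Classical in
/-- Exchange the colours `a` and `b` on the edges that meet `S`. -/
noncomputable def kempeSwap (φ : E → C) (a b : C) (S : Set N) (f : E) : C :=
  if ∃ v ∈ ends f, v ∈ S then Equiv.swap a b (φ f) else φ f

variable {ends}

theorem kempeSwap_of_mem [DecidableEq C] {φ : E → C} {a b : C} {S : Set N} {f : E} {v : N}
    (hv : v ∈ ends f) (hS : v ∈ S) : kempeSwap ends φ a b S f = Equiv.swap a b (φ f) := by
  rw [kempeSwap, if_pos ⟨v, hv, hS⟩]
  congr!

theorem kempeSwap_of_ne {φ : E → C} {a b : C} {S : Set N} {f : E} (ha : φ f ≠ a) (hb : φ f ≠ b) :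
    kempeSwap ends φ a b S f = φ f := by
  classical
  rw [kempeSwap]
  split_ifs
  · exact Equiv.swap_apply_of_ne_of_ne ha hb
  · rfl

theorem KempeClosed.swap_of_notMem {e : E} {φ : E → C} {a b : C} {S : Set N}
    (h : KempeClosed ends e φ a b S) {f : E} (hf : f ≠ e) {v : N} (hv : v ∈ ends f) (hS : v ∉ S) :
    kempeSwap ends φ a b S f = φ f := by
  by_cases hc : φ f = a ∨ φ f = b
  · rw [kempeSwap, if_neg]
    rintro ⟨u, hu, huS⟩
    exact hS (h f hf hc u hu v hv huS)
  · push Not at hc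
    exact kempeSwap_of_ne hc.1 hc.2

theorem KempeClosed.isProperOff {e : E} {φ : E → C} {a b : C} {S : Set N}
    (h : KempeClosed ends e φ a b S) (hφ : IsProperOff ends e φ) :
    IsProperOff ends e (kempeSwap ends φ a b S) := by
  classical
  intro f g hf hg hfg v hvf hvg
  by_cases hS : v ∈ S
  · rw [kempeSwap_of_mem hvf hS, kempeSwap_of_mem hvg hS]
    exact fun hh => hφ f g hf hg hfg v hvf hvg ((Equiv.swap a b).injective hh)
  · rw [h.swap_of_notMem hf hvf hS, h.swap_of_notMem hg hvg hS]
    exact hφ f g hf hg hfg v hvf hvg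

theorem KempeClosed.missing_of_notMem {e : E} {φ : E → C} {a b : C} {S : Set N}
    (h : KempeClosed ends e φ a b S) {v : N} (hS : v ∉ S) {c : C} (hc : Missing ends e φ v c) :
    Missing ends e (kempeSwap ends φ a b S) v c := by
  intro f hf hv
  rw [h.swap_of_notMem hf hv hS]
  exact hc f hf hv

theorem missing_kempeSwap_of_mem {e : E} {φ : E → C} {a b : C} {S : Set N} [DecidableEq C]
    {v : N} (hS : v ∈ S) {c : C} (hc : Missing ends e φ v (Equiv.swap a b c)) :
    Missing ends e (kempeSwap ends φ a b S) v c := by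
  intro f hf hv
  rw [kempeSwap_of_mem hv hS]
  intro h
  exact hc f hf hv (by rw [← h, Equiv.swap_apply_self])

theorem missing_kempeSwap_left {e : E} {φ : E → C} {a b : C} {S : Set N}
    {v : N} (hS : v ∈ S) (hc : Missing ends e φ v b) :
    Missing ends e (kempeSwap ends φ a b S) v a := by
  classical
  exact missing_kempeSwap_of_mem hS (by rwa [Equiv.swap_apply_left])

theorem missing_kempeSwap_right {e : E} {φ : E → C} {a b : C} {S : Set N}
    {v : N} (hS : v ∈ S) (hc : Missing ends e φ v a) :
    Missing ends e (kempeSwap ends φ a b S) v b := by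
  classical
  exact missing_kempeSwap_of_mem hS (by rwa [Equiv.swap_apply_right])

theorem KempeClosed.missing_of_ne {e : E} {φ : E → C} {a b : C} {S : Set N}
    (h : KempeClosed ends e φ a b S) {v : N} {c : C} (ha : c ≠ a) (hb : c ≠ b)
    (hc : Missing ends e φ v c) : Missing ends e (kempeSwap ends φ a b S) v c := by
  classical
  by_cases hS : v ∈ S
  · exact missing_kempeSwap_of_mem hS (by rwa [Equiv.swap_apply_of_ne_of_ne ha hb])
  · exact h.missing_of_notMem hS hc

theorem kempeClosed_reachable (e : E) (φ : E → C) (a b : C) (v : N) :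
    KempeClosed ends e φ a b {w | (kempeGraph ends (· ≠ e) φ a b).Reachable v w} := by
  intro f hf hc u hu w hw hr
  by_cases huw : u = w
  · exact huw ▸ hr
  · exact SimpleGraph.Reachable.trans hr (SimpleGraph.Adj.reachable
      ⟨huw, f, hf, ((Sym2.mem_and_mem_iff huw).1 ⟨hu, hw⟩), hc⟩)

/-- Properness gives each vertex at most one neighbour per colour, so a vertex lacking one of the
two colours has degree at most one. The predicate `P` is kept general because the final recolouring
follows chains that avoid the edges inside a triangle. -/
theorem kempeGraph_not_reachable [Finite N] {e : E} {φ : E → C} (hφ : IsProperOff ends e φ)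
    {P : E → Prop} (hP : ∀ f, P f → f ≠ e) {a b : C} {u v w : N}
    (huv : u ≠ v) (huw : u ≠ w) (hvw : v ≠ w)
    (hu : ∃ c, (c = a ∨ c = b) ∧ ∀ f, P f → u ∈ ends f → φ f ≠ c)
    (hv : ∃ c, (c = a ∨ c = b) ∧ ∀ f, P f → v ∈ ends f → φ f ≠ c)
    (hw : ∃ c, (c = a ∨ c = b) ∧ ∀ f, P f → w ∈ ends f → φ f ≠ c)
    (r₁ : (kempeGraph ends P φ a b).Reachable u v)
    (r₂ : (kempeGraph ends P φ a b).Reachable u w) : False := by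
  classical
  let R : C → N → Set N := fun c x => {y | ∃ f, P f ∧ ends f = s(x, y) ∧ φ f = c}
  have hsub : ∀ c x, (R c x).Subsingleton := by
    rintro c x y ⟨f, hf, hfe, hfc⟩ y' ⟨g, hg, hge, hgc⟩
    by_cases hfg : f = g
    · subst hfg
      rw [hfe] at hge
      exact Sym2.congr_right.1 hge
    · exact absurd (hfc.trans hgc.symm)
        (hφ f g (hP f hf) (hP g hg) hfg x (by rw [hfe]; simp) (by rw [hge]; simp))
  have hcard : ∀ c x, (R c x).ncard ≤ 1 := fun c x => Set.ncard_le_one_iff_subsingleton.2 (hsub c x)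
  have hnb : ∀ x, (kempeGraph ends P φ a b).neighborSet x ⊆ R a x ∪ R b x := by
    rintro x y ⟨_, f, hf, hfe, hfc | hfc⟩
    · exact Or.inl ⟨f, hf, hfe, hfc⟩
    · exact Or.inr ⟨f, hf, hfe, hfc⟩
  have hle : ∀ x, ((kempeGraph ends P φ a b).neighborSet x).ncard ≤
      (R a x).ncard + (R b x).ncard := fun x =>
    (Set.ncard_le_ncard (hnb x) (Set.toFinite _)).trans (Set.ncard_union_le _ _)
  have hone : ∀ x, (∃ c, (c = a ∨ c = b) ∧ ∀ f, P f → x ∈ ends f → φ f ≠ c) →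
      ((kempeGraph ends P φ a b).neighborSet x).ncard ≤ 1 := by
    rintro x ⟨c, hc, hx⟩
    have h0 : R c x = ∅ := by
      ext y
      simp only [R, Set.mem_ofPred_eq, Set.mem_empty_iff_false, iff_false]
      rintro ⟨f, hf, hfe, hfc⟩
      exact hx f hf (by rw [hfe]; simp) hfc
    have h0' : (R c x).ncard = 0 := by rw [h0, Set.ncard_empty]
    have := hle x
    have := hcard a x
    have := hcard b x
    rcases hc with rfl | rfl <;> omega
  exact not_reachable_of_degree_le_one (kempeGraph ends P φ a b)
    (fun x => by have := hle x; have := hcard a x; have := hcard b x; omega)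
    huv huw hvw (hone u hu) (hone v hv) (hone w hw) r₁ r₂

theorem kempeGraph_not_reachable_of_missing [Finite N] {e : E} {φ : E → C}
    (hφ : IsProperOff ends e φ) {a b : C} {u v w : N} (huv : u ≠ v) (huw : u ≠ w) (hvw : v ≠ w)
    (hu : Missing ends e φ u a ∨ Missing ends e φ u b)
    (hv : Missing ends e φ v a ∨ Missing ends e φ v b)
    (hw : Missing ends e φ w a ∨ Missing ends e φ w b)
    (r₁ : (kempeGraph ends (· ≠ e) φ a b).Reachable u v)
    (r₂ : (kempeGraph ends (· ≠ e) φ a b).Reachable u w) : False := by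
  have key : ∀ x, (Missing ends e φ x a ∨ Missing ends e φ x b) →
      ∃ c, (c = a ∨ c = b) ∧ ∀ f, f ≠ e → x ∈ ends f → φ f ≠ c := by
    rintro x (h | h)
    · exact ⟨a, Or.inl rfl, h⟩
    · exact ⟨b, Or.inr rfl, h⟩
  exact kempeGraph_not_reachable hφ (fun _ h => h) huv huw hvw (key u hu) (key v hv) (key w hw) r₁ r₂

end Kempe

/-! ### Vizing fans and Kierstead paths -/

section Elementary

variable {N E C : Type*} {ends : E → Sym2 N}

/-- Recolouring the edge `f` with a colour missing at both of its ends. -/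
theorem IsProperOff.update [DecidableEq E] {e f : E} {φ : E → C} (hφ : IsProperOff ends e φ)
    {c : C} (hc : ∀ v ∈ ends f, Missing ends e φ v c) :
    IsProperOff ends e (Function.update φ f c) := by
  intro g h hg hh hgh v hvg hvh
  by_cases h1 : g = f
  · subst h1
    rw [Function.update_self, Function.update_of_ne hgh.symm]
    exact (hc v hvg h hh hvh).symm
  · rw [Function.update_of_ne h1]
    by_cases h2 : h = f
    · subst h2
      rw [Function.update_self]
      exact hc v hvh g hg hvg
    · rw [Function.update_of_ne h2]
      exact hφ g h hg hh hgh v hvg hvh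

theorem Missing.update_of_notMem [DecidableEq E] {e f : E} {φ : E → C} {v : N} {c d : C}
    (h : Missing ends e φ v d) (hv : v ∉ ends f) : Missing ends e (Function.update φ f c) v d := by
  intro g hg hvg
  have : g ≠ f := by rintro rfl; exact hv hvg
  rw [Function.update_of_ne this]
  exact h g hg hvg

theorem IsProperOff.missing_update [DecidableEq E] {e f : E} {φ : E → C}
    (hφ : IsProperOff ends e φ) (hf : f ≠ e) {v : N} (hv : v ∈ ends f) {c : C} (hc : c ≠ φ f) :
    Missing ends e (Function.update φ f c) v (φ f) := by
  intro g hg hvg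
  by_cases h : g = f
  · subst h
    rwa [Function.update_self]
  · rw [Function.update_of_ne h]
    exact hφ g f hg hf h v hvg hv

/-- A colour missing at both ends of the uncoloured edge extends the colouring. -/
theorem IsProperOff.exists_proper {e : E} {φ : E → C} (hφ : IsProperOff ends e φ)
    {c : C} (hc : ∀ v ∈ ends e, Missing ends e φ v c) :
    ∃ ψ : E → C, ∀ f g, f ≠ g → ∀ v, v ∈ ends f → v ∈ ends g → ψ f ≠ ψ g := by
  classical
  refine ⟨Function.update φ e c, fun f g hfg v hf hg => ?_⟩
  by_cases h1 : f = e
  · subst h1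
    rw [Function.update_self, Function.update_of_ne hfg.symm]
    exact (hc v hf g hfg.symm hg).symm
  · rw [Function.update_of_ne h1]
    by_cases h2 : g = e
    · subst h2
      rw [Function.update_self]
      exact hc v hg f h1 hf
    · rw [Function.update_of_ne h2]
      exact hφ f g h1 h2 hfg v hf hg

/-- The multigraph has no proper edge colouring with colours in `C`. -/
def NotColorable (ends : E → Sym2 N) (C : Type*) : Prop :=
  ¬ ∃ ψ : E → C, ∀ f g, f ≠ g → ∀ v, v ∈ ends f → v ∈ ends g → ψ f ≠ ψ g

/-- A Vizing fan at `x` with `p + 1` distinct leaves `y 0, …, y p`. -/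
structure IsFan (ends : E → Sym2 N) (φ : E → C) (x : N) (y : ℕ → N) (f : ℕ → E) (p : ℕ) :
    Prop where
  proper : IsProperOff ends (f 0) φ
  ends_eq : ∀ i ≤ p, ends (f i) = s(x, y i)
  ne : ∀ i ≤ p, x ≠ y i
  inj : ∀ i ≤ p, ∀ j ≤ p, y i = y j → i = j
  missing : ∀ i ≤ p, i ≠ 0 → ∃ j < i, Missing ends (f 0) φ (y j) (φ (f i))

theorem IsFan.mono {φ : E → C} {x : N} {y : ℕ → N} {f : ℕ → E} {p q : ℕ}
    (h : IsFan ends φ x y f p) (hq : q ≤ p) : IsFan ends φ x y f q :=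
  ⟨h.proper, fun i hi => h.ends_eq i (hi.trans hq), fun i hi => h.ne i (hi.trans hq),
    fun i hi j hj => h.inj i (hi.trans hq) j (hj.trans hq), fun i hi => h.missing i (hi.trans hq)⟩

theorem IsFan.edge_inj {φ : E → C} {x : N} {y : ℕ → N} {f : ℕ → E} {p : ℕ}
    (h : IsFan ends φ x y f p) {i j : ℕ} (hi : i ≤ p) (hj : j ≤ p) (hij : f i = f j) : i = j := by
  have := h.ends_eq i hi
  rw [hij, h.ends_eq j hj] at this
  exact (h.inj j hj i hi (Sym2.congr_right.1 this)).symm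

theorem IsFan.mem_iff {φ : E → C} {x : N} {y : ℕ → N} {f : ℕ → E} {p : ℕ}
    (h : IsFan ends φ x y f p) {i j : ℕ} (hi : i ≤ p) (hj : j ≤ p) :
    y j ∈ ends (f i) ↔ i = j := by
  rw [h.ends_eq i hi, Sym2.mem_iff]
  constructor
  · rintro (h1 | h1)
    · exact absurd h1.symm (h.ne j hj)
    · exact (h.inj j hj i hi h1).symm
  · rintro rfl
    exact Or.inr rfl

/-- No colour is missing both at the centre and at a leaf of a fan. -/
theorem IsFan.not_missing_centre (hC : NotColorable ends C) {x : N} {y : ℕ → N} {f : ℕ → E}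
    (p : ℕ) : ∀ {φ : E → C}, IsFan ends φ x y f p → ∀ c, Missing ends (f 0) φ x c →
      ¬ Missing ends (f 0) φ (y p) c := by
  classical
  induction p using Nat.strong_induction_on with
  | _ p ih =>
  intro φ h c hx hy
  have hends : ∀ v ∈ ends (f p), Missing ends (f 0) φ v c := by
    intro v hv
    rw [h.ends_eq p le_rfl, Sym2.mem_iff] at hv
    rcases hv with rfl | rfl <;> assumption
  by_cases hp : p = 0
  · subst hp
    exact hC (h.proper.exists_proper hends)
  · obtain ⟨j, hj, hm⟩ := h.missing p le_rfl hp
    have hp0 : f p ≠ f 0 := fun hh => hp (h.edge_inj le_rfl (Nat.zero_le _) hh)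
    have hxp : x ∈ ends (f p) := by rw [h.ends_eq p le_rfl]; simp
    have hne : c ≠ φ (f p) := (hx _ hp0 hxp).symm
    have hnm : ∀ i < p, y i ∉ ends (f p) := fun i hi hh =>
      hi.ne' ((h.mem_iff le_rfl hi.le).1 hh)
    -- Giving `f p` the colour `c` frees its old colour at `x`. That colour is missing at the
    -- earlier leaf `y j`, so the fan cut off at `j` is a smaller counterexample.
    refine ih j hj (φ := Function.update φ (f p) c) ?_ (φ (f p))
      (h.proper.missing_update hp0 hxp hne) (hm.update_of_notMem (hnm j hj))
    refine ⟨h.proper.update hends, fun i hi => h.ends_eq i (hi.trans hj.le),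
      fun i hi => h.ne i (hi.trans hj.le), fun i hi l hl => h.inj i (hi.trans hj.le) l
      (hl.trans hj.le), fun i hi hi0 => ?_⟩
    obtain ⟨l, hl, hml⟩ := h.missing i (hi.trans hj.le) hi0
    refine ⟨l, hl, ?_⟩
    rw [Function.update_of_ne (fun hh => (hi.trans_lt hj).ne (h.edge_inj (hi.trans hj.le) le_rfl hh))]
    exact hml.update_of_notMem (hnm l ((hl.trans_le hi).trans hj))

theorem IsFan.missing_ne_centre (hC : NotColorable ends C) {x : N} {y : ℕ → N} {f : ℕ → E}
    {p : ℕ} {φ : E → C} (h : IsFan ends φ x y f p) {i : ℕ} (hi : i ≤ p) (c : C)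
    (hx : Missing ends (f 0) φ x c) : ¬ Missing ends (f 0) φ (y i) c :=
  (h.mono hi).not_missing_centre hC i c hx

/-- A fan stays a fan after a Kempe change that avoids its centre and all relevant leaves. -/
theorem IsFan.kempeSwap {φ : E → C} {x : N} {y : ℕ → N} {f : ℕ → E} {p : ℕ}
    (h : IsFan ends φ x y f p) {a b : C} {S : Set N} (hS : KempeClosed ends (f 0) φ a b S)
    (hx : x ∉ S) (hb : Missing ends (f 0) φ x b)
    (ha : ∀ i < p, Missing ends (f 0) φ (y i) a → y i ∉ S) :
    IsFan ends (kempeSwap ends φ a b S) x y f p := by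
  refine ⟨hS.isProperOff h.proper, h.ends_eq, h.ne, h.inj, fun i hi hi0 => ?_⟩
  obtain ⟨j, hj, hm⟩ := h.missing i hi hi0
  have hxi : x ∈ ends (f i) := by rw [h.ends_eq i hi]; simp
  have hne : f i ≠ f 0 := fun hh => hi0 (h.edge_inj hi (Nat.zero_le _) hh)
  refine ⟨j, hj, ?_⟩
  rw [hS.swap_of_notMem hne hxi hx]
  by_cases hca : φ (f i) = a
  · rw [hca] at hm ⊢
    exact hS.missing_of_notMem (ha j (hj.trans_le hi) hm) hm
  · exact hS.missing_of_ne hca (hb _ hne hxi) hm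

/-- No colour is missing at two leaves of a fan. -/
theorem IsFan.not_missing_leaves [Finite N] (hC : NotColorable ends C) {x : N} {y : ℕ → N}
    {f : ℕ → E} {φ : E → C} (hxm : ∃ b, Missing ends (f 0) φ x b) (p : ℕ) :
    IsFan ends φ x y f p → ∀ i < p, ∀ a, Missing ends (f 0) φ (y i) a →
      ¬ Missing ends (f 0) φ (y p) a := by
  induction p using Nat.strong_induction_on with
  | _ p ih =>
  intro h i hi a hia hpa
  obtain ⟨b, hb⟩ := hxm
  -- Among the leaves before `y p`, only `y i` can miss `a`; hence only `y i` could spoil the fan in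
  -- the Kempe change below.
  have IH : ∀ l < p, l ≠ i → ¬ Missing ends (f 0) φ (y l) a := by
    intro l hl hli hla
    rcases lt_or_gt_of_ne hli with hlt | hgt
    · exact ih i hi (h.mono hi.le) l hlt a hla hia
    · exact ih l hl (h.mono hl.le) i hgt a hia hla
  have hnr := kempeGraph_not_reachable_of_missing h.proper (a := a) (b := b)
    (h.ne i hi.le) (h.ne p le_rfl)
    (fun hh => hi.ne (h.inj i hi.le p le_rfl hh)) (Or.inr hb) (Or.inl hia) (Or.inl hpa)
  -- The centre shares its `a`-`b` chain with at most one of the two leaves. Swapping the chain of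
  -- the other leaf makes `b` missing there and at the centre.
  by_cases hr : (kempeGraph ends (· ≠ f 0) φ a b).Reachable (y i) x
  · have hpx : ¬ (kempeGraph ends (· ≠ f 0) φ a b).Reachable (y p) x :=
      fun hh => hnr hr.symm hh.symm
    have hS := kempeClosed_reachable (ends := ends) (f 0) φ a b (y p)
    have hF := h.kempeSwap hS hpx hb (fun l hl hla hmem => by
      have hli : l = i := by_contra fun hli => IH l hl hli hla
      subst hli
      exact hpx (SimpleGraph.Reachable.trans hmem hr))
    exact hF.not_missing_centre hC p b (hS.missing_of_notMem hpx hb)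
      (missing_kempeSwap_right (SimpleGraph.Reachable.refl _) hpa)
  · have hS := kempeClosed_reachable (ends := ends) (f 0) φ a b (y i)
    have hF := (h.mono hi.le).kempeSwap hS hr hb (fun l hl hla => absurd hla (IH l (hl.trans hi) hl.ne))
    exact hF.not_missing_centre hC i b (hS.missing_of_notMem hr hb)
      (missing_kempeSwap_right (SimpleGraph.Reachable.refl _) hia)

/-- A Kierstead path `y 0, …, y p` with edges `f 0, …, f (p - 1)`, the first one uncoloured. -/
structure IsKierstead (ends : E → Sym2 N) (φ : E → C) (y : ℕ → N) (f : ℕ → E) (p : ℕ) :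
    Prop where
  proper : IsProperOff ends (f 0) φ
  ends_eq : ∀ i < p, ends (f i) = s(y i, y (i + 1))
  inj : ∀ i ≤ p, ∀ j ≤ p, y i = y j → i = j
  missing : ∀ i < p, i ≠ 0 → ∃ j ≤ i, Missing ends (f 0) φ (y j) (φ (f i))

theorem IsKierstead.mono {φ : E → C} {y : ℕ → N} {f : ℕ → E} {p q : ℕ}
    (h : IsKierstead ends φ y f p) (hq : q ≤ p) : IsKierstead ends φ y f q :=
  ⟨h.proper, fun i hi => h.ends_eq i (hi.trans_le hq),
    fun i hi j hj => h.inj i (hi.trans hq) j (hj.trans hq),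
    fun i hi => h.missing i (hi.trans_le hq)⟩

theorem IsKierstead.mem_iff {φ : E → C} {y : ℕ → N} {f : ℕ → E} {p : ℕ}
    (h : IsKierstead ends φ y f p) {i j : ℕ} (hi : i < p) (hj : j ≤ p) :
    y j ∈ ends (f i) ↔ j = i ∨ j = i + 1 := by
  rw [h.ends_eq i hi, Sym2.mem_iff]
  constructor
  · rintro (h1 | h1)
    · exact Or.inl (h.inj j hj i hi.le h1)
    · exact Or.inr (h.inj j hj (i + 1) hi h1)
  · rintro (rfl | rfl) <;> simp

theorem IsKierstead.edge_inj {φ : E → C} {y : ℕ → N} {f : ℕ → E} {p : ℕ}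
    (h : IsKierstead ends φ y f p) {i j : ℕ} (hi : i < p) (hj : j < p) (hij : f i = f j) :
    i = j := by
  have h1 := (h.mem_iff hi hi.le).2 (Or.inl rfl)
  have h2 := (h.mem_iff hj hj.le).2 (Or.inl rfl)
  rw [hij, h.mem_iff hj hi.le] at h1
  rw [← hij, h.mem_iff hi hj.le] at h2
  omega

/-- A Kempe change at colours missing at `y i` and `y (i + 1)` fixes the path up to there. -/
theorem IsKierstead.kempeSwap_prefix {φ : E → C} {y : ℕ → N} {f : ℕ → E} {p : ℕ}
    (h : IsKierstead ends φ y f p)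
    (hel : ∀ i j, i < j → j < p → ∀ c, Missing ends (f 0) φ (y i) c →
      ¬ Missing ends (f 0) φ (y j) c)
    {i : ℕ} (hi : i + 1 < p) {a b : C} (ha : Missing ends (f 0) φ (y i) a)
    (hb : Missing ends (f 0) φ (y (i + 1)) b) {S : Set N}
    (hS : KempeClosed ends (f 0) φ a b S) :
    ∀ j < i + 1, j ≠ 0 → kempeSwap ends φ a b S (f j) = φ (f j) ∧ ∃ l ≤ j,
      Missing ends (f 0) (kempeSwap ends φ a b S) (y l) (φ (f j)) := by
  intro j hj hj0
  obtain ⟨l, hl, hm⟩ := h.missing j (hj.trans hi) hj0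
  have hne : f j ≠ f 0 := fun hh => hj0 (h.edge_inj (hj.trans hi) (by omega) hh)
  have hlj : l ≠ j := by
    rintro rfl
    exact hm _ hne ((h.mem_iff (hj.trans hi) (hj.trans hi).le).2 (Or.inl rfl)) rfl
  -- The colour of `f j` is missing at a vertex before `y i`, so disjointness along the shorter path
  -- separates it from `a` and, below, from `b`.
  have hca : φ (f j) ≠ a := by
    intro hh
    rw [hh] at hm
    exact hel l i (by omega) (by omega) a hm ha
  have hcb : φ (f j) ≠ b := by
    intro hh
    rw [hh] at hm
    exact hel l (i + 1) (by omega) hi b hm hb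
  exact ⟨kempeSwap_of_ne hca hcb, l, hl, hS.missing_of_ne hca hcb hm⟩

/-- Kierstead's theorem: no colour is missing at two vertices of a Kierstead path. -/
theorem IsKierstead.not_missing [Finite N] (hC : NotColorable ends C) {y : ℕ → N} {f : ℕ → E}
    (hmiss : ∀ φ : E → C, IsProperOff ends (f 0) φ → ∀ v, ∃ c, Missing ends (f 0) φ v c) (p : ℕ) :
    ∀ {φ : E → C}, IsKierstead ends φ y f p → ∀ i < p, ∀ c, Missing ends (f 0) φ (y i) c →
      ¬ Missing ends (f 0) φ (y p) c := by
  classical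
  induction p using Nat.strong_induction_on with
  | _ p ih =>
  -- Inside the induction on `p`, a second induction on the distance between the two vertices, with
  -- the colouring left free since it changes.
  suffices key : ∀ n i, i + 1 + n = p → ∀ φ : E → C, IsKierstead ends φ y f p → ∀ c,
      Missing ends (f 0) φ (y i) c → ¬ Missing ends (f 0) φ (y p) c from
    fun {φ} h i hi c => key (p - (i + 1)) i (by omega) φ h c
  intro n
  induction n with
  | zero =>
    rintro i rfl φ h c hi hp
    have hends : ∀ v ∈ ends (f i), Missing ends (f 0) φ v c := by
      intro v hv
      rw [h.ends_eq i (by omega), Sym2.mem_iff] at hv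
      rcases hv with rfl | rfl <;> assumption
    by_cases hi0 : i = 0
    · subst hi0
      exact hC (h.proper.exists_proper hends)
    · obtain ⟨l, hl, hm⟩ := h.missing i (by omega) hi0
      have hne : f i ≠ f 0 := fun hh => hi0 (h.edge_inj (by omega) (by omega) hh)
      have hmem : y i ∈ ends (f i) := (h.mem_iff (by omega) (by omega)).2 (Or.inl rfl)
      have hli : l ≠ i := by
        rintro rfl
        exact hm _ hne hmem rfl
      have hlt : l < i := lt_of_le_of_ne hl hli
      have hnm : ∀ j < i, y j ∉ ends (f i) := fun j hj hh => by
        have := (h.mem_iff (by omega) (by omega)).1 hh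
        omega
      -- After recolouring the last edge with `c`, its old colour is missing at `y i` and at an
      -- earlier `y l`: a clash on a shorter path.
      refine ih i (by omega) (φ := Function.update φ (f i) c) ?_ l hlt (φ (f i))
        (hm.update_of_notMem (hnm l hlt)) (h.proper.missing_update hne hmem (hi _ hne hmem).symm)
      refine ⟨h.proper.update hends, fun j hj => h.ends_eq j (by omega),
        fun j hj m hm => h.inj j (by omega) m (by omega), fun j hj hj0 => ?_⟩
      obtain ⟨m, hm, hmm⟩ := h.missing j (by omega) hj0
      refine ⟨m, hm, ?_⟩
      rw [Function.update_of_ne (fun hh => hj.ne (h.edge_inj (by omega) (by omega) hh))]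
      exact hmm.update_of_notMem (hnm m (by omega))
  | succ n ihn =>
    intro i hip φ h a hia hpa
    have hi1 : i + 1 < p := by omega
    -- Swap the `a`-`b` chain of `y p`. It contains at most one of `y i` and `y (i + 1)`; if it
    -- contains one, these two then miss a common colour, a clash on a shorter path.
    obtain ⟨b, hb⟩ := hmiss φ h.proper (y (i + 1))
    have hel : ∀ i j, i < j → j < p → ∀ c, Missing ends (f 0) φ (y i) c →
        ¬ Missing ends (f 0) φ (y j) c := fun i j hij hj c => ih j hj (h.mono hj.le) i hij c
    have hnr := kempeGraph_not_reachable_of_missing h.proper (a := a) (b := b) (u := y p)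
      (v := y i) (w := y (i + 1))
      (fun hh => by have := h.inj _ le_rfl _ (by omega) hh; omega)
      (fun hh => by have := h.inj _ le_rfl _ (by omega) hh; omega)
      (fun hh => by have := h.inj _ (by omega) _ (by omega) hh; omega)
      (Or.inl hpa) (Or.inl hia) (Or.inr hb)
    have hS := kempeClosed_reachable (ends := ends) (f 0) φ a b (y p)
    set S : Set N := {w | (kempeGraph ends (· ≠ f 0) φ a b).Reachable (y p) w} with hSdef
    have hpS : y p ∈ S := SimpleGraph.Reachable.refl _
    have hpre := h.kempeSwap_prefix hel hi1 hia hb hS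
    have hK : IsKierstead ends (kempeSwap ends φ a b S) y f (i + 1) := by
      refine ⟨hS.isProperOff h.proper, fun j hj => h.ends_eq j (by omega),
        fun j hj m hm => h.inj j (by omega) m (by omega), fun j hj hj0 => ?_⟩
      rw [(hpre j hj hj0).1]
      exact (hpre j hj hj0).2
    by_cases h1 : y i ∈ S
    · have h2 : y (i + 1) ∉ S := fun h2 => hnr h1 h2
      exact ih (i + 1) hi1 hK i (by omega) b (missing_kempeSwap_right h1 hia)
        (hS.missing_of_notMem h2 hb)
    · by_cases h2 : y (i + 1) ∈ S
      · exact ih (i + 1) hi1 hK i (by omega) a (hS.missing_of_notMem h1 hia)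
          (missing_kempeSwap_left h2 hb)
      -- The chain avoids both vertices. Later edges may exchange `a` and `b`, but these remain
      -- missing at `y i` and `y (i + 1)`, so the whole path survives, and now `b` is missing at `y
      -- (i + 1)` and `y p`, which are one step closer.
      · have hK' : IsKierstead ends (kempeSwap ends φ a b S) y f p := by
          refine ⟨hS.isProperOff h.proper, h.ends_eq, h.inj, fun j hj hj0 => ?_⟩
          rcases lt_or_ge j (i + 1) with hlt | hge
          · rw [(hpre j hlt hj0).1]
            exact (hpre j hlt hj0).2
          · have hor : kempeSwap ends φ a b S (f j) = a ∨ kempeSwap ends φ a b S (f j) = b ∨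
                (kempeSwap ends φ a b S (f j) = φ (f j) ∧ φ (f j) ≠ a ∧ φ (f j) ≠ b) := by
              by_cases hca : φ (f j) = a
              · unfold kempeSwap
                split_ifs
                · exact Or.inr (Or.inl (by rw [hca, Equiv.swap_apply_left]))
                · exact Or.inl hca
              · by_cases hcb : φ (f j) = b
                · unfold kempeSwap
                  split_ifs
                  · exact Or.inl (by rw [hcb, Equiv.swap_apply_right])
                  · exact Or.inr (Or.inl hcb)
                · exact Or.inr (Or.inr ⟨kempeSwap_of_ne hca hcb, hca, hcb⟩)
            rcases hor with hh | hh | ⟨hh, hca, hcb⟩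
            · rw [hh]
              exact ⟨i, by omega, hS.missing_of_notMem h1 hia⟩
            · rw [hh]
              exact ⟨i + 1, hge, hS.missing_of_notMem h2 hb⟩
            · rw [hh]
              obtain ⟨l, hl, hm⟩ := h.missing j hj hj0
              exact ⟨l, hl, hS.missing_of_ne hca hcb hm⟩
        exact ihn (i + 1) (by omega) _ hK' b (hS.missing_of_notMem h2 hb)
          (missing_kempeSwap_right hpS hpa)

end Elementary

/-! ### Counting missing colours in critical multigraphs; the bound on the maximum degree -/

section Critical

variable {N E : Type*} {ends : E → Sym2 N} {k : ℕ}

open Classical in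
/-- The colours missing at a vertex. -/
noncomputable def missingColors (ends : E → Sym2 N) (e : E) (φ : E → Fin k) (v : N) :
    Finset (Fin k) :=
  Finset.univ.filter fun c => Missing ends e φ v c

theorem mem_missingColors {e : E} {φ : E → Fin k} {v : N} {c : Fin k} :
    c ∈ missingColors ends e φ v ↔ Missing ends e φ v c := by
  simp [missingColors]

/-- Vertices without common missing colours have at most `k` missing colours together. -/
theorem sum_card_missingColors_le {e : E} {φ : E → Fin k} (y : ℕ → N) (n : ℕ)
    (h : ∀ i j, i < j → j < n → ∀ c, Missing ends e φ (y i) c → ¬ Missing ends e φ (y j) c) :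
    ∑ i ∈ Finset.range n, (missingColors ends e φ (y i)).card ≤ k := by
  classical
  rw [← Finset.card_biUnion]
  · exact (Finset.card_le_univ _).trans (by simp)
  · intro i hi j hj hij
    rw [Finset.mem_coe, Finset.mem_range] at hi hj
    rw [Function.onFun, Finset.disjoint_left]
    intro c hc hc'
    rw [mem_missingColors] at hc hc'
    rcases lt_or_gt_of_ne hij with hlt | hgt
    · exact h i j hlt hj c hc hc'
    · exact h j i hgt hi c hc' hc

variable [Fintype E] {D W : E → ℕ}

open Classical in
/-- The edges at a vertex. -/
noncomputable def edgesAt (ends : E → Sym2 N) (v : N) : Finset E :=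
  Finset.univ.filter fun f => v ∈ ends f

open Classical in
/-- The edges joining two vertices. -/
noncomputable def edgesBetween (ends : E → Sym2 N) (u v : N) : Finset E :=
  Finset.univ.filter fun f => ends f = s(u, v)

theorem mem_edgesAt {v : N} {f : E} : f ∈ edgesAt ends v ↔ v ∈ ends f := by
  simp [edgesAt]

theorem mem_edgesBetween {u v : N} {f : E} : f ∈ edgesBetween ends u v ↔ ends f = s(u, v) := by
  simp [edgesBetween]

theorem edgesBetween_comm (u v : N) : edgesBetween ends u v = edgesBetween ends v u := by
  ext f
  rw [mem_edgesBetween, mem_edgesBetween, Sym2.eq_swap]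

theorem edgesBetween_subset_left (u v : N) : edgesBetween ends u v ⊆ edgesAt ends u := by
  intro f hf
  rw [mem_edgesBetween] at hf
  rw [mem_edgesAt, hf]
  simp

theorem edgesBetween_subset_right (u v : N) : edgesBetween ends u v ⊆ edgesAt ends v := by
  rw [edgesBetween_comm]
  exact edgesBetween_subset_left v u

theorem card_edgesBetween_add_le {x y z : N} (hyz : y ≠ z) :
    (edgesBetween ends x y).card + (edgesBetween ends x z).card ≤ (edgesAt ends x).card := by
  classical
  rw [← Finset.card_union_of_disjoint]
  · exact Finset.card_le_card (Finset.union_subset (edgesBetween_subset_left _ _)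
      (edgesBetween_subset_left _ _))
  · rw [Finset.disjoint_left]
    intro f hf hf'
    rw [mem_edgesBetween] at hf hf'
    rw [hf] at hf'
    exact hyz (Sym2.congr_right.1 hf')

theorem card_edgesBetween_add_add_le {x y z w : N} (hyz : y ≠ z) (hyw : y ≠ w) (hzw : z ≠ w) :
    (edgesBetween ends x y).card + (edgesBetween ends x z).card + (edgesBetween ends x w).card ≤
      (edgesAt ends x).card := by
  classical
  rw [← Finset.card_union_of_disjoint, ← Finset.card_union_of_disjoint]
  · exact Finset.card_le_card (Finset.union_subset (Finset.union_subset
      (edgesBetween_subset_left _ _) (edgesBetween_subset_left _ _)) (edgesBetween_subset_left _ _))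
  · rw [Finset.disjoint_left]
    intro f hf hf'
    rw [Finset.mem_union, mem_edgesBetween, mem_edgesBetween] at hf
    rw [mem_edgesBetween] at hf'
    rw [hf'] at hf
    rcases hf with hf | hf
    · exact hyw (Sym2.congr_right.1 hf).symm
    · exact hzw (Sym2.congr_right.1 hf).symm
  · rw [Finset.disjoint_left]
    intro f hf hf'
    rw [mem_edgesBetween] at hf hf'
    rw [hf] at hf'
    exact hyz (Sym2.congr_right.1 hf')

theorem le_card_missingColors_add (e : E) (φ : E → Fin k) (v : N) :
    k ≤ (missingColors ends e φ v).card + (edgesAt ends v).card := by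
  classical
  have h : (Finset.univ : Finset (Fin k)) ⊆
      missingColors ends e φ v ∪ (edgesAt ends v).image φ := by
    intro c _
    rw [Finset.mem_union, mem_missingColors, Finset.mem_image]
    by_cases hc : Missing ends e φ v c
    · exact Or.inl hc
    · unfold Missing at hc
      push Not at hc
      obtain ⟨f, _, hv, hf⟩ := hc
      exact Or.inr ⟨f, mem_edgesAt.2 hv, hf⟩
  have h1 := Finset.card_le_card h
  rw [Finset.card_univ, Fintype.card_fin] at h1
  exact h1.trans ((Finset.card_union_le _ _).trans (by gcongr; exact Finset.card_image_le))

/-- The uncoloured edge counts towards the degree of `v` but uses no colour, which gains one over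
`le_card_missingColors_add`. -/
theorem lt_card_missingColors_add {e : E} (φ : E → Fin k) {v : N} (hv : v ∈ ends e) :
    k < (missingColors ends e φ v).card + (edgesAt ends v).card := by
  classical
  have h : (Finset.univ : Finset (Fin k)) ⊆
      missingColors ends e φ v ∪ ((edgesAt ends v).erase e).image φ := by
    intro c _
    rw [Finset.mem_union, mem_missingColors, Finset.mem_image]
    by_cases hc : Missing ends e φ v c
    · exact Or.inl hc
    · unfold Missing at hc
      push Not at hc
      obtain ⟨f, hfe, hv, hf⟩ := hc
      exact Or.inr ⟨f, Finset.mem_erase.2 ⟨hfe, mem_edgesAt.2 hv⟩, hf⟩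
  have h1 := Finset.card_le_card h
  rw [Finset.card_univ, Fintype.card_fin] at h1
  have h2 := Finset.card_union_le (missingColors ends e φ v) (((edgesAt ends v).erase e).image φ)
  have h3 : (((edgesAt ends v).erase e).image φ).card ≤ ((edgesAt ends v).erase e).card :=
    Finset.card_image_le
  have h4 := Finset.card_erase_lt_of_mem (mem_edgesAt.2 hv)
  omega

/-- An edge-critical multigraph which is not `k`-edge-colourable, such that the averages of
`D + W` over small cliques of the line graph are bounded by `2 * k`, where `D` and `W` are bounds
for the closed degrees and the local clique numbers. -/
structure IsCriticalBounded (ends : E → Sym2 N) (k : ℕ) (D W : E → ℕ) : Prop where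
  loopless : ∀ f, ¬ (ends f).IsDiag
  notColorable : NotColorable ends (Fin k)
  exists_colouring : ∀ e, ∃ φ : E → Fin k, IsProperOff ends e φ
  degree_le : ∀ f u v, ends f = s(u, v) →
    (edgesAt ends u).card + (edgesAt ends v).card ≤ D f + (edgesBetween ends u v).card
  clique_le : ∀ K : Finset E, (∀ f ∈ K, ∀ g ∈ K, f ≠ g → ∃ v, v ∈ ends f ∧ v ∈ ends g) →
    ∀ f ∈ K, K.card ≤ W f
  pos : 0 < k
  pair_le : ∀ f g, f ≠ g → (∃ v, v ∈ ends f ∧ v ∈ ends g) →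
    3 ≤ k ∨ D f + W f + (D g + W g) ≤ 4 * k
  triple_le : ∀ f g h, f ≠ g → f ≠ h → g ≠ h → (∃ v, v ∈ ends f ∧ v ∈ ends g) →
    (∃ v, v ∈ ends f ∧ v ∈ ends h) → (∃ v, v ∈ ends g ∧ v ∈ ends h) →
    D f + W f + (D g + W g) + (D h + W h) ≤ 6 * k

namespace IsCriticalBounded

theorem nonempty (H : IsCriticalBounded ends k D W) : Nonempty E := by
  by_contra hE
  rw [not_nonempty_iff] at hE
  exact H.notColorable ⟨fun e => hE.elim e, fun e => hE.elim e⟩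

theorem ne_of_ends (H : IsCriticalBounded ends k D W) {f : E} {u v : N} (h : ends f = s(u, v)) :
    u ≠ v := by
  rintro rfl
  exact H.loopless f (by rw [h]; simp)

theorem degree_le_clique (H : IsCriticalBounded ends k D W) {f : E} {v : N} (hv : v ∈ ends f) :
    (edgesAt ends v).card ≤ W f :=
  H.clique_le _ (fun _ hf _ hg _ => ⟨v, mem_edgesAt.1 hf, mem_edgesAt.1 hg⟩) f (mem_edgesAt.2 hv)

theorem degree_le_degree (H : IsCriticalBounded ends k D W) {f : E} {v : N} (hv : v ∈ ends f) :
    (edgesAt ends v).card ≤ D f := by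
  obtain ⟨u, hu⟩ := hv
  have h1 := H.degree_le f v u hu
  have h2 := Finset.card_le_card (edgesBetween_subset_right (ends := ends) v u)
  omega

theorem two_le_clique (H : IsCriticalBounded ends k D W) {f g : E} (hfg : f ≠ g)
    (h : ∃ v, v ∈ ends f ∧ v ∈ ends g) : 2 ≤ W f := by
  classical
  have := H.clique_le {f, g} (by
    intro a ha b hb hab
    simp only [Finset.mem_insert, Finset.mem_singleton] at ha hb
    obtain ⟨v, hv⟩ := h
    rcases ha with rfl | rfl <;> rcases hb with rfl | rfl
    · exact absurd rfl hab
    · exact ⟨v, hv⟩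
    · exact ⟨v, hv.symm⟩
    · exact absurd rfl hab) f (by simp)
  rwa [Finset.card_pair hfg] at this

theorem not_missing_ends (H : IsCriticalBounded ends k D W) {e : E} {x y : N}
    (he : ends e = s(x, y)) {φ : E → Fin k} (hφ : IsProperOff ends e φ) {c : Fin k}
    (hx : Missing ends e φ x c) : ¬ Missing ends e φ y c := by
  intro hy
  refine H.notColorable (hφ.exists_proper (c := c) fun v hv => ?_)
  rw [he, Sym2.mem_iff] at hv
  rcases hv with rfl | rfl <;> assumption

theorem card_missing_ends (H : IsCriticalBounded ends k D W) {e : E} {x y : N}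
    (he : ends e = s(x, y)) {φ : E → Fin k} (hφ : IsProperOff ends e φ) :
    (missingColors ends e φ x).card + (missingColors ends e φ y).card ≤ k := by
  classical
  rw [← Finset.card_union_of_disjoint]
  · exact (Finset.card_le_univ _).trans (by simp)
  · rw [Finset.disjoint_left]
    intro c hc hc'
    exact H.not_missing_ends he hφ (mem_missingColors.1 hc) (mem_missingColors.1 hc')

/-- A vertex of degree at most `k` has no pendant neighbour. -/
theorem edgesBetween_lt (H : IsCriticalBounded ends k D W) {e : E} {x y : N}
    (he : ends e = s(x, y)) (hx : (edgesAt ends x).card ≤ k) :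
    (edgesBetween ends x y).card < (edgesAt ends y).card := by
  by_contra hle
  obtain ⟨φ, hφ⟩ := H.exists_colouring e
  have h1 := lt_card_missingColors_add φ (v := x) (ends := ends) (e := e) (by rw [he]; simp)
  obtain ⟨c, hc⟩ := Finset.card_pos.1 (show 0 < (missingColors ends e φ x).card by omega)
  rw [mem_missingColors] at hc
  have hy := H.not_missing_ends he hφ hc
  unfold Missing at hy
  push Not at hy
  obtain ⟨f, hfe, hyf, hfc⟩ := hy
  -- If all edges at `y` led to `x`, a colour missing at `x` would also be missing at `y`.
  have heq := Finset.eq_of_subset_of_card_le (edgesBetween_subset_right (ends := ends) x y)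
    (not_lt.1 hle)
  have : f ∈ edgesBetween ends x y := by rw [heq]; exact mem_edgesAt.2 hyf
  rw [mem_edgesBetween] at this
  exact hc f hfe (by rw [this]; simp) hfc

/-- Three edges at `x` have `D, W ≥ Δ`, so `6Δ ≤ 6k`. Now `edgesBetween_lt` applies and raises one
`D` to `Δ + 1`, making the inequality strict. For `Δ = 2` the same argument uses the bound on pairs;
`Δ = 1` is excluded by counting missing colours at both ends of an edge. -/
theorem degree_lt_of_max (H : IsCriticalBounded ends k D W) {x : N}
    (hx : ∀ v, (edgesAt ends v).card ≤ (edgesAt ends x).card) : (edgesAt ends x).card < k := by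
  obtain ⟨e₀⟩ := H.nonempty
  obtain ⟨v₀, hv₀⟩ : ∃ v, v ∈ ends e₀ := ⟨(ends e₀).out.1, Sym2.out_fst_mem _⟩
  have hpos : 0 < (edgesAt ends x).card :=
    (Finset.card_pos.2 ⟨e₀, mem_edgesAt.2 hv₀⟩).trans_le (hx v₀)
  by_cases h3 : 3 ≤ (edgesAt ends x).card
  · obtain ⟨f, g, h, hf, hg, hh, hfg, hfh, hgh⟩ := (Finset.two_lt_card_iff).1 h3
    rw [mem_edgesAt] at hf hg hh
    have ht := H.triple_le f g h hfg hfh hgh ⟨x, hf, hg⟩ ⟨x, hf, hh⟩ ⟨x, hg, hh⟩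
    have h1 := H.degree_le_clique hf
    have h2 := H.degree_le_clique hg
    have h3 := H.degree_le_clique hh
    have h5 := H.degree_le_degree hg
    have h6 := H.degree_le_degree hh
    obtain ⟨y, hy⟩ := hf
    have h4 := H.degree_le f x y hy
    have h7 := H.degree_le_degree (f := f) (v := x) (by rw [hy]; simp)
    have h8 := H.edgesBetween_lt hy (by omega)
    omega
  · obtain ⟨e, he⟩ := Finset.card_pos.1 hpos
    have hxe := mem_edgesAt.1 he
    obtain ⟨y, hy⟩ := mem_edgesAt.1 he
    obtain ⟨φ, hφ⟩ := H.exists_colouring e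
    have h1 := lt_card_missingColors_add φ hxe
    have h2 := lt_card_missingColors_add φ (v := y) (ends := ends) (e := e) (by rw [hy]; simp)
    have h4 := H.card_missing_ends hy hφ
    have h5 := hx y
    have hk := H.pos
    by_cases h2' : (edgesAt ends x).card = 2
    · obtain ⟨g, hg, hge⟩ :=
        Finset.exists_mem_ne (show 1 < (edgesAt ends x).card by omega) e
      rw [mem_edgesAt] at hg
      have w1 := H.two_le_clique hge.symm ⟨x, hxe, hg⟩
      have w2 := H.two_le_clique hge ⟨x, hg, hxe⟩
      have d1 := H.degree_le_degree hxe
      have d2 := H.degree_le_degree hg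
      have d3 := H.degree_le e x y hy
      rcases H.pair_le e g hge.symm ⟨x, hxe, hg⟩ with h | h
      · omega
      · have h8 := H.edgesBetween_lt hy (by omega)
        omega
    · omega

end IsCriticalBounded

end Critical

/-! ### Fans with two leaves and their triangle -/

section Critical

variable {N E : Type*} {ends : E → Sym2 N} {k : ℕ}

/-- The edges `e = xy` (uncoloured) and `f = xz` form a fan at `x`. -/
structure IsTwoFan (ends : E → Sym2 N) (φ : E → Fin k) (e f : E) (x y z : N) : Prop where
  proper : IsProperOff ends e φ
  ends_left : ends e = s(x, y)
  ends_right : ends f = s(x, z)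
  ne : y ≠ z
  missing : Missing ends e φ y (φ f)

theorem IsTwoFan.edge_ne {φ : E → Fin k} {e f : E} {x y z : N} (h : IsTwoFan ends φ e f x y z) :
    f ≠ e := by
  rintro rfl
  have := h.ends_right
  rw [h.ends_left] at this
  exact h.ne (Sym2.congr_right.1 this)

theorem exists_of_not_missing {φ : E → Fin k} {e : E} {v : N} {c : Fin k} (h : ¬ Missing ends e φ v c) :
    ∃ g, g ≠ e ∧ v ∈ ends g ∧ φ g = c := by
  unfold Missing at h
  push Not at h
  exact h

variable [Fintype E] {D W : E → ℕ}

namespace IsCriticalBounded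

theorem exists_missing (H : IsCriticalBounded ends k D W) {x : N}
    (hx : ∀ v, (edgesAt ends v).card ≤ (edgesAt ends x).card) (e : E) (φ : E → Fin k) (v : N) :
    ∃ c, Missing ends e φ v c := by
  have h1 := H.degree_lt_of_max hx
  have h2 := hx v
  have h3 := le_card_missingColors_add (ends := ends) e φ v
  obtain ⟨c, hc⟩ := Finset.card_pos.1 (show 0 < (missingColors ends e φ v).card by omega)
  exact ⟨c, mem_missingColors.1 hc⟩

/-- There is no fan with three leaves at a vertex of maximum degree. -/
theorem not_three_fan [Finite N] (H : IsCriticalBounded ends k D W) {x : N}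
    (hx : ∀ v, (edgesAt ends v).card ≤ (edgesAt ends x).card) {φ : E → Fin k} {e f g : E}
    {y z w : N} (h : IsTwoFan ends φ e f x y z) (hg : ends g = s(x, w)) (hwy : w ≠ y) (hwz : w ≠ z)
    (hm : Missing ends e φ y (φ g) ∨ Missing ends e φ z (φ g)) : False := by
  let Y : ℕ → N := fun i => if i = 0 then y else if i = 1 then z else w
  let F : ℕ → E := fun i => if i = 0 then e else if i = 1 then f else g
  have hxy := H.ne_of_ends h.ends_left
  have hxz := H.ne_of_ends h.ends_right
  have hxw := H.ne_of_ends hg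
  have hF : IsFan ends φ x Y F 2 := by
    refine ⟨h.proper, fun i hi => ?_, fun i hi => ?_, fun i hi j hj => ?_, fun i hi hi0 => ?_⟩
    · interval_cases i
      · exact h.ends_left
      · exact h.ends_right
      · exact hg
    · interval_cases i
      · exact hxy
      · exact hxz
      · exact hxw
    · interval_cases i <;> interval_cases j <;>
        simp [Y, h.ne, h.ne.symm, hwy, hwy.symm, hwz, hwz.symm]
    · interval_cases i
      · exact absurd rfl hi0
      · exact ⟨0, by omega, h.missing⟩
      · rcases hm with hm | hm
        · exact ⟨0, by omega, hm⟩
        · exact ⟨1, by omega, hm⟩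
  have hmx := H.exists_missing hx e φ x
  have hsum := sum_card_missingColors_le (ends := ends) (e := e) (φ := φ)
    (fun i => if i = 0 then x else Y (i - 1)) 4 (by
      intro i j hij hj c hi
      have hj0 : j ≠ 0 := by omega
      simp only [hj0, if_false]
      by_cases hi0 : i = 0
      · simp only [hi0, if_true] at hi
        exact hF.missing_ne_centre H.notColorable (by omega) c hi
      · simp only [hi0, if_false] at hi
        exact (hF.mono (show j - 1 ≤ 2 by omega)).not_missing_leaves H.notColorable hmx (j - 1)
          (i - 1) (by omega) c hi)
  simp only [Finset.sum_range_succ, Finset.sum_range_zero, Y] at hsum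
  norm_num at hsum
  have mx := lt_card_missingColors_add φ (v := x) (ends := ends) (e := e)
    (by rw [h.ends_left]; simp)
  have my := lt_card_missingColors_add φ (v := y) (ends := ends) (e := e)
    (by rw [h.ends_left]; simp)
  have mz := le_card_missingColors_add (ends := ends) e φ z
  have mw := le_card_missingColors_add (ends := ends) e φ w
  have xe : x ∈ ends e := by rw [h.ends_left]; simp
  have xf : x ∈ ends f := by rw [h.ends_right]; simp
  have xg : x ∈ ends g := by rw [hg]; simp
  have hfg : f ≠ g := by
    rintro rfl
    rw [h.ends_right] at hg
    exact hwz (Sym2.congr_right.1 hg).symm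
  have heg : e ≠ g := by
    rintro rfl
    rw [h.ends_left] at hg
    exact hwy (Sym2.congr_right.1 hg).symm
  have ht := H.triple_le e f g h.edge_ne.symm heg hfg ⟨x, xe, xf⟩ ⟨x, xe, xg⟩ ⟨x, xf, xg⟩
  have w1 := H.degree_le_clique xe
  have w2 := H.degree_le_clique xf
  have w3 := H.degree_le_clique xg
  have d1 := H.degree_le e x y h.ends_left
  have d2 := H.degree_le f x z h.ends_right
  have d3 := H.degree_le g x w hg
  -- The three multiplicities sum to at most `Δ`, so the averages give `5Δ + d(y) + d(z) + d(w) ≤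
  -- 6k`. Disjointness gives `Δ + d(y) + d(z) + d(w) ≥ 3k + 2`, hence `4Δ ≥ 3k + 2`; together these
  -- are contradictory.
  have hmu := card_edgesBetween_add_add_le (ends := ends) (x := x) h.ne hwy.symm hwz.symm
  have m1 := hx y
  have m2 := hx z
  have m3 := hx w
  omega

variable {x : N} {φ : E → Fin k} {e f : E} {y z : N}

theorem not_missing_right [Finite N] (H : IsCriticalBounded ends k D W)
    (hx : ∀ v, (edgesAt ends v).card ≤ (edgesAt ends x).card) (h : IsTwoFan ends φ e f x y z)
    {c : Fin k} (hz : Missing ends e φ z c) :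
    ¬ Missing ends e φ x c ∧ ¬ Missing ends e φ y c := by
  let Y : ℕ → N := fun i => if i = 0 then y else z
  let F : ℕ → E := fun i => if i = 0 then e else f
  have hF : IsFan ends φ x Y F 1 := by
    refine ⟨h.proper, fun i hi => ?_, fun i hi => ?_, fun i hi j hj => ?_, fun i hi hi0 => ?_⟩
    · interval_cases i
      · exact h.ends_left
      · exact h.ends_right
    · interval_cases i
      · exact H.ne_of_ends h.ends_left
      · exact H.ne_of_ends h.ends_right
    · interval_cases i <;> interval_cases j <;> simp [Y, h.ne, h.ne.symm]
    · interval_cases i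
      · exact absurd rfl hi0
      · exact ⟨0, by omega, h.missing⟩
  exact ⟨fun hx => hF.not_missing_centre H.notColorable 1 c hx hz,
    fun hy => hF.not_missing_leaves H.notColorable (H.exists_missing hx e φ x) 1 0 (by omega) c
      hy hz⟩

/-- Edges at `x` with a colour missing at `y` lead to `z`. -/
theorem ends_of_missing_left [Finite N] (H : IsCriticalBounded ends k D W)
    (hx : ∀ v, (edgesAt ends v).card ≤ (edgesAt ends x).card) (h : IsTwoFan ends φ e f x y z)
    {g : E} (hge : g ≠ e) (hxg : x ∈ ends g) (hy : Missing ends e φ y (φ g)) :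
    ends g = s(x, z) := by
  obtain ⟨w, hw⟩ := hxg
  by_cases hwz : w = z
  · rw [hw, hwz]
  · refine (H.not_three_fan hx h hw ?_ hwz (Or.inl hy)).elim
    rintro rfl
    exact hy g hge (by rw [hw]; simp) rfl

/-- Edges at `x` with a colour missing at `z` lead to `y`. -/
theorem ends_of_missing_right [Finite N] (H : IsCriticalBounded ends k D W)
    (hx : ∀ v, (edgesAt ends v).card ≤ (edgesAt ends x).card) (h : IsTwoFan ends φ e f x y z)
    {g : E} (hge : g ≠ e) (hxg : x ∈ ends g) (hz : Missing ends e φ z (φ g)) :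
    ends g = s(x, y) := by
  obtain ⟨w, hw⟩ := hxg
  by_cases hwy : w = y
  · rw [hw, hwy]
  · refine (H.not_three_fan hx h hw hwy ?_ (Or.inr hz)).elim
    rintro rfl
    exact hz g hge (by rw [hw]; simp) rfl

/-- A colour missing at `y` must occur at `x`, and there only on edges to `z`. -/
theorem card_missing_left_le [Finite N] (H : IsCriticalBounded ends k D W)
    (hx : ∀ v, (edgesAt ends v).card ≤ (edgesAt ends x).card) (h : IsTwoFan ends φ e f x y z) :
    (missingColors ends e φ y).card ≤ (edgesBetween ends x z).card := by
  classical
  refine (Finset.card_le_card (t := (edgesBetween ends x z).image φ) fun c hc => ?_).trans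
    Finset.card_image_le
  rw [mem_missingColors] at hc
  obtain ⟨g, hge, hxg, rfl⟩ := exists_of_not_missing (ends := ends) (e := e) (φ := φ) (v := x)
    (fun hxc => H.not_missing_ends h.ends_left h.proper hxc hc)
  exact Finset.mem_image_of_mem _ (mem_edgesBetween.2 (H.ends_of_missing_left hx h hge hxg hc))

/-- The mirror image for `z`; it is strict because the uncoloured `e` is among the edges `xy`. -/
theorem card_missing_right_lt [Finite N] (H : IsCriticalBounded ends k D W)
    (hx : ∀ v, (edgesAt ends v).card ≤ (edgesAt ends x).card) (h : IsTwoFan ends φ e f x y z) :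
    (missingColors ends e φ z).card < (edgesBetween ends x y).card := by
  classical
  refine lt_of_le_of_lt ((Finset.card_le_card (t := ((edgesBetween ends x y).erase e).image φ)
    fun c hc => ?_).trans Finset.card_image_le)
    (Finset.card_erase_lt_of_mem (mem_edgesBetween.2 h.ends_left))
  rw [mem_missingColors] at hc
  obtain ⟨g, hge, hxg, rfl⟩ := exists_of_not_missing (H.not_missing_right hx h hc).1
  exact Finset.mem_image_of_mem _ (Finset.mem_erase.2
    ⟨hge, mem_edgesBetween.2 (H.ends_of_missing_right hx h hge hxg hc)⟩)

/-- Since `y` misses two colours and `z` one, both `xy` and `xz` have multiplicity at least two. The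
triples with two edges `xy` and one `xz`, and the reverse, add up to three times the inequality. -/
theorem degree_add_degree_le [Finite N] (H : IsCriticalBounded ends k D W)
    (hx : ∀ v, (edgesAt ends v).card ≤ (edgesAt ends x).card) (h : IsTwoFan ends φ e f x y z) :
    4 * (edgesAt ends x).card + (edgesAt ends y).card + (edgesAt ends z).card ≤
      4 * k + (edgesBetween ends x y).card + (edgesBetween ends x z).card := by
  have h1 := H.degree_lt_of_max hx
  have hz := hx z
  have hy := hx y
  have h2 := H.card_missing_left_le hx h
  have h3 := H.card_missing_right_lt hx h
  have h4 := le_card_missingColors_add (ends := ends) e φ z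
  have h5 := lt_card_missingColors_add φ (v := y) (ends := ends) (e := e)
    (by rw [h.ends_left]; simp)
  obtain ⟨e', he', hne'⟩ := Finset.exists_mem_ne
    (show 1 < (edgesBetween ends x y).card by omega) e
  obtain ⟨f', hf', hnf'⟩ := Finset.exists_mem_ne
    (show 1 < (edgesBetween ends x z).card by omega) f
  rw [mem_edgesBetween] at he' hf'
  have xe : x ∈ ends e := by rw [h.ends_left]; simp
  have xf : x ∈ ends f := by rw [h.ends_right]; simp
  have xe' : x ∈ ends e' := by rw [he']; simp
  have xf' : x ∈ ends f' := by rw [hf']; simp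
  have key : ∀ a b, ends a = s(x, y) → ends b = s(x, z) → a ≠ b := by
    rintro a b ha hb rfl
    rw [ha] at hb
    exact h.ne (Sym2.congr_right.1 hb)
  have t1 := H.triple_le e e' f hne'.symm h.edge_ne.symm (key _ _ he' h.ends_right)
    ⟨x, xe, xe'⟩ ⟨x, xe, xf⟩ ⟨x, xe', xf⟩
  have t2 := H.triple_le e f f' h.edge_ne.symm (key _ _ h.ends_left hf') hnf'.symm
    ⟨x, xe, xf⟩ ⟨x, xe, xf'⟩ ⟨x, xf, xf'⟩
  have w1 := H.degree_le_clique xe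
  have w2 := H.degree_le_clique xf
  have w3 := H.degree_le_clique xe'
  have w4 := H.degree_le_clique xf'
  have d1 := H.degree_le e x y h.ends_left
  have d2 := H.degree_le f x z h.ends_right
  have d3 := H.degree_le e' x y he'
  have d4 := H.degree_le f' x z hf'
  omega

/-- Every colour missing at `x` appears on an edge joining `y` and `z`. -/
theorem exists_edge_of_missing [Finite N] (H : IsCriticalBounded ends k D W)
    (hx : ∀ v, (edgesAt ends v).card ≤ (edgesAt ends x).card) (h : IsTwoFan ends φ e f x y z)
    {c : Fin k} (hc : Missing ends e φ x c) : ∃ g, g ≠ e ∧ ends g = s(y, z) ∧ φ g = c := by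
  classical
  obtain ⟨g, hge, ⟨w, hg⟩, hgc⟩ := exists_of_not_missing (ends := ends) (e := e) (φ := φ) (v := y)
    (H.not_missing_ends h.ends_left h.proper hc)
  obtain ⟨g', hge', ⟨w', hg'⟩, hgc'⟩ := exists_of_not_missing (ends := ends) (e := e) (φ := φ)
    (v := z) (fun hz => (H.not_missing_right hx h hz).1 hc)
  -- Otherwise `c` leaves the triangle at `y` and at `z`, on edges `g = yw` and `g' = zw'`.
  by_contra hno
  push Not at hno
  have hxy := H.ne_of_ends h.ends_left
  have hxz := H.ne_of_ends h.ends_right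
  have hyw := H.ne_of_ends hg
  have hzw' := H.ne_of_ends hg'
  have hwz : w ≠ z := by rintro rfl; exact hno g hge hg hgc
  have hw'y : w' ≠ y := by rintro rfl; exact hno g' hge' (hg'.trans Sym2.eq_swap) hgc'
  have hwx : w ≠ x := by rintro rfl; exact hc g hge (by rw [hg]; simp) hgc
  have hw'x : w' ≠ x := by rintro rfl; exact hc g' hge' (by rw [hg']; simp) hgc'
  have hgg' : g ≠ g' := by
    rintro rfl
    rw [hg, Sym2.eq_iff] at hg'
    rcases hg' with ⟨h1, -⟩ | ⟨h1, -⟩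
    · exact h.ne h1
    · exact hw'y h1.symm
  have hww' : w ≠ w' := by
    rintro rfl
    exact h.proper g g' hge hge' hgg' w (by rw [hg]; simp) (by rw [hg']; simp)
      (hgc.trans hgc'.symm)
  have hxf : x ∈ ends f := by rw [h.ends_right]; simp
  have hfc : φ f ≠ c := hc f h.edge_ne hxf
  have hyf : y ∉ ends f := fun hyf => h.missing f h.edge_ne hyf rfl
  have hgf : g ≠ f := fun hh => hfc (hh ▸ hgc)
  have hg'f : g' ≠ f := fun hh => hfc (hh ▸ hgc')
  -- Move the uncoloured edge: `e` receives `c` and `g` loses it. Then `w` misses `c`, and `w, y, x,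
  -- z, w'` is a Kierstead path.
  let ψ : E → Fin k := Function.update φ e c
  have ψe : ψ e = c := Function.update_self ..
  have ψne : ∀ a, a ≠ e → ψ a = φ a := fun a ha => Function.update_of_ne ha ..
  have hψ : IsProperOff ends g ψ := by
    have aux : ∀ b, b ≠ e → b ≠ g → ∀ v, v ∈ ends e → v ∈ ends b → φ b ≠ c := by
      intro b hbe hbg v hve hvb
      rw [h.ends_left, Sym2.mem_iff] at hve
      rcases hve with rfl | rfl
      · exact hc b hbe hvb
      · rw [← hgc]
        exact h.proper b g hbe hge hbg v hvb (by rw [hg]; simp)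
    intro a b hag hbg hab v hva hvb
    by_cases ha : a = e
    · subst ha
      rw [ψe, ψne b hab.symm]
      exact (aux b hab.symm hbg v hva hvb).symm
    · by_cases hb : b = e
      · subst hb
        rw [ψe, ψne a ha]
        exact aux a ha hag v hvb hva
      · rw [ψne a ha, ψne b hb]
        exact h.proper a b ha hb hab v hva hvb
  have hwc : Missing ends g ψ w c := by
    intro a hag hwa
    by_cases ha : a = e
    · subst ha
      rw [h.ends_left, Sym2.mem_iff] at hwa
      rcases hwa with hh | hh
      · exact absurd hh hwx
      · exact absurd hh.symm hyw
    · rw [ψne a ha, ← hgc]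
      exact h.proper a g ha hge hag w hwa (by rw [hg]; simp)
  have hyc : Missing ends g ψ y (φ f) := by
    intro a hag hya
    by_cases ha : a = e
    · subst ha
      rw [ψe]
      exact hfc.symm
    · rw [ψne a ha]
      exact h.missing a ha hya
  let Y : ℕ → N := fun i => if i = 0 then w else if i = 1 then y else if i = 2 then x else
    if i = 3 then z else w'
  let F : ℕ → E := fun i => if i = 0 then g else if i = 1 then e else if i = 2 then f else g'
  have hK : IsKierstead ends ψ Y F 4 := by
    refine ⟨hψ, fun i hi => ?_, fun i hi j hj => ?_, fun i hi hi0 => ?_⟩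
    · interval_cases i
      · exact hg.trans Sym2.eq_swap
      · exact h.ends_left.trans Sym2.eq_swap
      · exact h.ends_right
      · exact hg'
    · interval_cases i <;> interval_cases j <;>
        simp [Y, h.ne, h.ne.symm, hxy, hxy.symm, hxz, hxz.symm, hyw, hyw.symm, hzw', hzw'.symm,
          hwz, hwz.symm, hw'y, hw'y.symm, hwx, hwx.symm, hw'x, hw'x.symm, hww', hww'.symm]
    · interval_cases i
      · exact absurd rfl hi0
      · exact ⟨0, by omega, by simpa [Y, F, ψe] using hwc⟩
      · exact ⟨1, by omega, by simpa [Y, F, ψne f h.edge_ne] using hyc⟩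
      · exact ⟨0, by omega, by simpa [Y, F, ψne g' hge', hgc'] using hwc⟩
  have hsum := sum_card_missingColors_le (ends := ends) (e := g) (φ := ψ) Y 5
    fun i j hij hj c hi => (hK.mono (show j ≤ 4 by omega)).not_missing H.notColorable
      (fun χ _ v => H.exists_missing hx g χ v) j i hij c hi
  simp only [Finset.sum_range_succ, Finset.sum_range_zero, Y] at hsum
  norm_num at hsum
  have m1 := lt_card_missingColors_add ψ (v := y) (ends := ends) (e := g) (by rw [hg]; simp)
  have m2 := lt_card_missingColors_add ψ (v := w) (ends := ends) (e := g) (by rw [hg]; simp)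
  have m3 := le_card_missingColors_add (ends := ends) g ψ x
  have m4 := le_card_missingColors_add (ends := ends) g ψ z
  have m5 := le_card_missingColors_add (ends := ends) g ψ w'
  -- Disjointness on the five vertices needs degree sum at least `4k + 2`. Here `d(y) + d(z) ≤ 4k -
  -- 3Δ`, and `x, w, w'` contribute at most `3Δ`.
  have hA := H.degree_add_degree_le hx h
  have hmu := card_edgesBetween_add_le (ends := ends) (x := x) h.ne
  have d1 := hx w
  have d2 := hx w'
  have d3 := H.degree_lt_of_max hx
  omega

/-- Every colour missing at a vertex of the triangle is on an edge joining the other two. -/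
theorem exists_inner_edge [Finite N] (H : IsCriticalBounded ends k D W)
    (hx : ∀ v, (edgesAt ends v).card ≤ (edgesAt ends x).card) (h : IsTwoFan ends φ e f x y z)
    {c : Fin k} {u : N} (hu : u ∈ ({x, y, z} : Set N)) (hc : Missing ends e φ u c) :
    ∃ g, g ≠ e ∧ φ g = c ∧ (∀ v ∈ ends g, v ∈ ({x, y, z} : Set N)) ∧
      ∀ p ∈ ({x, y, z} : Set N), p ≠ u → p ∈ ends g := by
  simp only [Set.mem_insert_iff, Set.mem_singleton_iff] at hu ⊢
  rcases hu with rfl | rfl | rfl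
  · obtain ⟨g, hge, hg, hgc⟩ := H.exists_edge_of_missing hx h hc
    refine ⟨g, hge, hgc, ?_, ?_⟩ <;> rw [hg] <;> simp only [Sym2.mem_iff] <;> tauto
  · obtain ⟨g, hge, hxg, rfl⟩ := exists_of_not_missing (ends := ends) (e := e) (φ := φ) (v := x)
      (fun hxc => H.not_missing_ends h.ends_left h.proper hxc hc)
    have hg := H.ends_of_missing_left hx h hge hxg hc
    refine ⟨g, hge, rfl, ?_, ?_⟩ <;> rw [hg] <;> simp only [Sym2.mem_iff] <;> tauto
  · obtain ⟨g, hge, hxg, rfl⟩ := exists_of_not_missing (H.not_missing_right hx h hc).1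
    have hg := H.ends_of_missing_right hx h hge hxg hc
    refine ⟨g, hge, rfl, ?_, ?_⟩ <;> rw [hg] <;> simp only [Sym2.mem_iff] <;> tauto

/-- Some colour is on no edge of the triangle. -/
theorem exists_outer_color [Finite N] (H : IsCriticalBounded ends k D W)
    (hx : ∀ v, (edgesAt ends v).card ≤ (edgesAt ends x).card) (h : IsTwoFan ends φ e f x y z) :
    ∃ b, ∀ g, g ≠ e → (∀ v ∈ ends g, v ∈ ({x, y, z} : Set N)) → φ g ≠ b := by
  classical
  by_contra! hno
  choose G hG using hno
  let I : Finset E := edgesBetween ends x y ∪ edgesBetween ends x z ∪ edgesBetween ends y z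
  have hmemI : ∀ g, g ∈ I ↔ ends g = s(x, y) ∨ ends g = s(x, z) ∨ ends g = s(y, z) := by
    intro g
    simp only [I, Finset.mem_union, mem_edgesBetween, or_assoc]
  have hI : ∀ g, (∀ v ∈ ends g, v ∈ ({x, y, z} : Set N)) → g ∈ I := by
    intro g hg
    rw [hmemI]
    have hl := H.loopless g
    induction hs : ends g using Sym2.ind with
    | _ u v =>
    rw [hs] at hg hl
    have hu := hg u (by simp)
    have hv := hg v (by simp)
    simp only [Set.mem_insert_iff, Set.mem_singleton_iff] at hu hv
    rw [Sym2.mk_isDiag_iff] at hl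
    rcases hu with rfl | rfl | rfl <;> rcases hv with rfl | rfl | rfl <;> simp at hl ⊢
  have hcard : I.card ≤ (edgesBetween ends x y).card + (edgesBetween ends x z).card +
      (edgesBetween ends y z).card :=
    (Finset.card_union_le _ _).trans (by gcongr; exact Finset.card_union_le _ _)
  have hcard' : I.card = (edgesBetween ends x y).card + (edgesBetween ends x z).card +
      (edgesBetween ends y z).card := by
    rw [← Finset.card_union_of_disjoint, ← Finset.card_union_of_disjoint]
    · rw [Finset.disjoint_left]
      intro g hg hg'
      rw [Finset.mem_union, mem_edgesBetween, mem_edgesBetween] at hg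
      rw [mem_edgesBetween] at hg'
      have hxg : x ∈ ends g := by rcases hg with hg | hg <;> rw [hg] <;> simp
      rw [hg', Sym2.mem_iff] at hxg
      rcases hxg with hh | hh
      · exact H.ne_of_ends h.ends_left hh
      · exact H.ne_of_ends h.ends_right hh
    · rw [Finset.disjoint_left]
      intro g hg hg'
      rw [mem_edgesBetween] at hg hg'
      rw [hg] at hg'
      exact h.ne (Sym2.congr_right.1 hg')
  have heI : e ∈ I := (hmemI e).2 (Or.inl h.ends_left)
  -- If all `k` colours occurred inside the triangle, then with `e` it would contain at least `k +
  -- 1` edges.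
  have hk : k ≤ (I.erase e).card := by
    have : (Finset.univ : Finset (Fin k)) ⊆ (I.erase e).image φ := fun b _ =>
      Finset.mem_image.2 ⟨G b, Finset.mem_erase.2 ⟨(hG b).1, hI _ (hG b).2.1⟩, (hG b).2.2⟩
    have h1 := (Finset.card_le_card this).trans Finset.card_image_le
    rwa [Finset.card_univ, Fintype.card_fin] at h1
  have hk' := Finset.card_erase_lt_of_mem heI
  have hmeet : ∀ a ∈ I, ∀ b ∈ I, a ≠ b → ∃ v, v ∈ ends a ∧ v ∈ ends b := by
    intro a ha b hb _
    rw [hmemI] at ha hb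
    rcases ha with ha | ha | ha <;> rcases hb with hb | hb | hb <;> rw [ha, hb]
    exacts [⟨x, by simp⟩, ⟨x, by simp⟩, ⟨y, by simp⟩, ⟨x, by simp⟩, ⟨x, by simp⟩, ⟨z, by simp⟩,
      ⟨y, by simp⟩, ⟨z, by simp⟩, ⟨y, by simp⟩]
  obtain ⟨c, hc⟩ := H.exists_missing hx e φ x
  obtain ⟨g, hge, hg, hgc⟩ := H.exists_edge_of_missing hx h hc
  have hfI : f ∈ I := (hmemI f).2 (Or.inr (Or.inl h.ends_right))
  have hgI : g ∈ I := (hmemI g).2 (Or.inr (Or.inr hg))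
  have hfg : f ≠ g := by
    rintro rfl
    exact hc f hge (by rw [h.ends_right]; simp) hgc
  have ht := H.triple_le e f g h.edge_ne.symm hge.symm hfg (hmeet e heI f hfI h.edge_ne.symm)
    (hmeet e heI g hgI hge.symm) (hmeet f hfI g hgI hfg)
  have w1 := H.clique_le I hmeet e heI
  have w2 := H.clique_le I hmeet f hfI
  have w3 := H.clique_le I hmeet g hgI
  have d1 := H.degree_le e x y h.ends_left
  have d2 := H.degree_le f x z h.ends_right
  have d3 := H.degree_le g y z hg
  let Y : ℕ → N := fun i => if i = 0 then x else if i = 1 then y else z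
  have hsum := sum_card_missingColors_le (ends := ends) (e := e) (φ := φ) Y 3 (by
    intro i j hij hj c hi hj'
    interval_cases j
    · omega
    · interval_cases i
      exact H.not_missing_ends h.ends_left h.proper hi hj'
    · interval_cases i
      · exact (H.not_missing_right hx h hj').1 hi
      · exact (H.not_missing_right hx h hj').2 hi)
  simp only [Finset.sum_range_succ, Finset.sum_range_zero, Y] at hsum
  norm_num at hsum
  have m1 := lt_card_missingColors_add φ (v := x) (ends := ends) (e := e)
    (by rw [h.ends_left]; simp)
  have m2 := lt_card_missingColors_add φ (v := y) (ends := ends) (e := e)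
    (by rw [h.ends_left]; simp)
  have m3 := le_card_missingColors_add (ends := ends) e φ z
  -- The triple `e, f, g` gives `2(d(x) + d(y) + d(z)) - |I| + 3|I| ≤ 6k`, whereas disjointness
  -- gives degree sum at least `2k + 2`, and `|I| ≥ k + 1`.
  omega

end IsCriticalBounded

end Critical

/-! ### Recolouring outside the triangle and the final contradiction -/

section Critical

variable {N E : Type*} {ends : E → Sym2 N} {k : ℕ} [Fintype E] {D W : E → ℕ}

namespace IsCriticalBounded

variable {x : N} {φ : E → Fin k} {e f : E} {y z : N}

/-- Edges at the triangle with a colour missing in the triangle do not leave it. -/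
theorem inner_of_missing [Finite N] (H : IsCriticalBounded ends k D W)
    (hx : ∀ v, (edgesAt ends v).card ≤ (edgesAt ends x).card) (h : IsTwoFan ends φ e f x y z)
    {u p : N} (hu : u ∈ ({x, y, z} : Set N)) (hp : p ∈ ({x, y, z} : Set N)) {g : E} (hge : g ≠ e)
    (hpg : p ∈ ends g) (hm : Missing ends e φ u (φ g)) :
    ∀ v ∈ ends g, v ∈ ({x, y, z} : Set N) := by
  obtain ⟨g', hge', hc, hin, hp'⟩ := H.exists_inner_edge hx h hu hm
  have hpu : p ≠ u := by
    rintro rfl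
    exact hm g hge hpg rfl
  have : g' = g := by
    by_contra hne
    exact h.proper g' g hge' hge hne p (hp' p hp hpu) hpg hc
  exact this ▸ hin

/-- Given a colour `b` that is on no edge of the triangle, there is a colouring such that `b` is
missing at one vertex of the triangle and on edges leaving the triangle at the other two. -/
theorem exists_recolouring [Finite N] (H : IsCriticalBounded ends k D W)
    (hx : ∀ v, (edgesAt ends v).card ≤ (edgesAt ends x).card) (h : IsTwoFan ends φ e f x y z)
    {b : Fin k} (hb : ∀ g, g ≠ e → (∀ v ∈ ends g, v ∈ ({x, y, z} : Set N)) → φ g ≠ b) :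
    ∃ ψ : E → Fin k, IsTwoFan ends ψ e f x y z ∧ ∃ u ∈ ({x, y, z} : Set N),
      Missing ends e ψ u b ∧ ∀ p ∈ ({x, y, z} : Set N), p ≠ u →
        ∃ g, g ≠ e ∧ p ∈ ends g ∧ ψ g = b ∧ ¬ ∀ v ∈ ends g, v ∈ ({x, y, z} : Set N) := by
  classical
  set T : Set N := {x, y, z} with hT
  have hxT : x ∈ T := by simp [hT]
  have hyT : y ∈ T := by simp [hT]
  have hzT : z ∈ T := by simp [hT]
  have hxy := H.ne_of_ends h.ends_left
  have hxz := H.ne_of_ends h.ends_right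
  have hbm : ∀ p ∈ T, ¬ Missing ends e φ p b := by
    intro p hp hm
    obtain ⟨g, hge, hgb, hin, -⟩ := H.exists_inner_edge hx h hp hm
    exact hb g hge hin hgb
  obtain ⟨a, ha⟩ := H.exists_missing hx e φ x
  let P : E → Prop := fun g => g ≠ e ∧ ¬ ∀ v ∈ ends g, v ∈ T
  set Γ := kempeGraph ends P φ b a with hΓ
  -- No `a`-edge leaves `T`, so in `Γ` each vertex of `T` has degree at most one. Hence the three
  -- are not all in one component, and some `u` is separated from the other two.
  have haP : ∀ p ∈ T, ∃ c, (c = b ∨ c = a) ∧ ∀ g, P g → p ∈ ends g → φ g ≠ c := by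
    intro p hp
    refine ⟨a, Or.inr rfl, fun g hg hpg hga => hg.2 ?_⟩
    exact H.inner_of_missing hx h hxT hp hg.1 hpg (hga ▸ ha)
  have hnr : ¬ (Γ.Reachable x y ∧ Γ.Reachable x z) := fun hr =>
    kempeGraph_not_reachable h.proper (fun g hg => hg.1) hxy hxz h.ne (haP x hxT) (haP y hyT)
      (haP z hzT) hr.1 hr.2
  obtain ⟨u, huT, hu⟩ : ∃ u ∈ T, ∀ p ∈ T, p ≠ u → ¬ Γ.Reachable u p := by
    have mem : ∀ p, p ∈ T ↔ p = x ∨ p = y ∨ p = z := fun p => by simp [hT]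
    by_cases h1 : Γ.Reachable x y
    · refine ⟨z, hzT, fun p hp hpz hr => ?_⟩
      rcases (mem p).1 hp with rfl | rfl | rfl
      · exact hnr ⟨h1, hr.symm⟩
      · exact hnr ⟨h1, h1.trans hr.symm⟩
      · exact hpz rfl
    · by_cases h2 : Γ.Reachable x z
      · refine ⟨y, hyT, fun p hp hpy hr => ?_⟩
        rcases (mem p).1 hp with rfl | rfl | rfl
        · exact h1 hr.symm
        · exact hpy rfl
        · exact h1 (h2.trans hr.symm)
      · refine ⟨x, hxT, fun p hp hpx hr => ?_⟩
        rcases (mem p).1 hp with rfl | rfl | rfl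
        · exact hpx rfl
        · exact h1 hr
        · exact h2 hr
  -- Avoiding `φ f` keeps the fan intact. Only `u = y` needs care: there two colours are missing, as
  -- `e` is uncoloured and `Δ < k`.
  obtain ⟨c, hc, hcf⟩ : ∃ c, Missing ends e φ u c ∧ c ≠ φ f := by
    by_cases huy : u = y
    · subst huy
      have h1 := lt_card_missingColors_add φ (v := u) (ends := ends) (e := e)
        (by rw [h.ends_left]; simp)
      have h2 := hx u
      have h3 := H.degree_lt_of_max hx
      obtain ⟨c, hc, hne⟩ := Finset.exists_mem_ne
        (show 1 < (missingColors ends e φ u).card by omega) (φ f)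
      exact ⟨c, mem_missingColors.1 hc, hne⟩
    · obtain ⟨c, hc⟩ := H.exists_missing hx e φ u
      refine ⟨c, hc, ?_⟩
      rintro rfl
      simp only [hT, Set.mem_insert_iff, Set.mem_singleton_iff] at huT
      rcases huT with rfl | rfl | rfl
      · exact hc f h.edge_ne (by rw [h.ends_right]; simp) rfl
      · exact huy rfl
      · exact (H.not_missing_right hx h hc).2 h.missing
  have hcb : c ≠ b := by rintro rfl; exact hbm u huT hc
  have hab : a ≠ b := by rintro rfl; exact hbm x hxT ha
  have hin : ∀ g, g ≠ e → φ g = a ∨ φ g = c → ∀ p ∈ T, p ∈ ends g → ∀ v ∈ ends g, v ∈ T := by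
    rintro g hge (hg | hg) p hp hpg
    · exact H.inner_of_missing hx h hxT hp hge hpg (hg ▸ ha)
    · exact H.inner_of_missing hx h huT hp hge hpg (hg ▸ hc)
  -- Neither `a` nor `c` leaves `T`, so they may be exchanged outside `T`. This turns the `b`-`a`
  -- component of `u` in `Γ` into a `b`-`c` chain.
  have hS₁ : KempeClosed ends e φ a c Tᶜ := by
    intro g hge hg v hv w hw hvT hwT
    exact hvT (hin g hge hg w hwT hw v hv)
  set φ₁ := kempeSwap ends φ a c Tᶜ with hφ₁
  have hφ₁T : ∀ g, g ≠ e → ∀ p ∈ T, p ∈ ends g → φ₁ g = φ g := fun g hge p hp hpg =>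
    hS₁.swap_of_notMem hge hpg (fun hh => hh hp)
  have hm₁ : ∀ p ∈ T, ∀ d, Missing ends e φ p d → Missing ends e φ₁ p d := fun p hp d hd =>
    hS₁.missing_of_notMem (fun hh => hh hp) hd
  -- The only vertex of `T` in this component is `u`, where `c` is missing and no inner edge has
  -- colour `b`; so the chain uses no inner edge.
  have hS₂ : KempeClosed ends e φ₁ b c {w | Γ.Reachable u w} := by
    intro g hge hg v hv w hw hr
    by_cases hvw : v = w
    · exact hvw ▸ hr
    have hgs := (Sym2.mem_and_mem_iff hvw).1 ⟨hv, hw⟩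
    suffices hh : P g ∧ (φ g = b ∨ φ g = a) from
      SimpleGraph.Reachable.trans hr (SimpleGraph.Adj.reachable ⟨hvw, g, hh.1, hgs, hh.2⟩)
    by_cases hT' : ∃ p ∈ T, p ∈ ends g
    · obtain ⟨p, hp, hpg⟩ := hT'
      rw [hφ₁T g hge p hp hpg] at hg
      by_cases hgin : ∀ v ∈ ends g, v ∈ T
      · have hvu : v = u := by
          by_contra hvu
          exact hu v (hgin v hv) hvu hr
        subst hvu
        rcases hg with hg | hg
        · exact absurd hg (hb g hge hgin)
        · exact absurd hg (hc g hge hv)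
      · refine ⟨⟨hge, hgin⟩, ?_⟩
        rcases hg with hg | hg
        · exact Or.inl hg
        · exact absurd (hin g hge (Or.inr hg) p hp hpg) hgin
    · push Not at hT'
      have hvT : v ∉ T := fun hh => hT' v hh hv
      refine ⟨⟨hge, fun hh => hvT (hh v hv)⟩, ?_⟩
      rw [hφ₁, kempeSwap_of_mem hv hvT] at hg
      rcases hg with hg | hg
      · rw [Equiv.swap_apply_eq_iff, Equiv.swap_apply_of_ne_of_ne hab.symm hcb.symm] at hg
        exact Or.inl hg
      · rw [Equiv.swap_apply_eq_iff, Equiv.swap_apply_right] at hg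
        exact Or.inr hg
  have hxf : x ∈ ends f := by rw [h.ends_right]; simp
  have hfin : ∀ v ∈ ends f, v ∈ T := by
    intro v hv
    rw [h.ends_right, Sym2.mem_iff] at hv
    rcases hv with rfl | rfl <;> assumption
  have hfb : φ f ≠ b := hb f h.edge_ne hfin
  have hf₁ : φ₁ f = φ f := hφ₁T f h.edge_ne x hxT hxf
  have hf₂ : kempeSwap ends φ₁ b c {w | Γ.Reachable u w} f = φ f := by
    rw [kempeSwap_of_ne (by rwa [hf₁]) (by rw [hf₁]; exact hcf.symm), hf₁]
  refine ⟨kempeSwap ends φ₁ b c {w | Γ.Reachable u w},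
    ⟨hS₂.isProperOff (hS₁.isProperOff h.proper), h.ends_left, h.ends_right, h.ne, ?_⟩, u, huT,
    missing_kempeSwap_left (SimpleGraph.Reachable.refl _) (hm₁ u huT c hc), fun p hp hpu => ?_⟩
  · rw [hf₂]
    exact hS₂.missing_of_ne hfb hcf.symm (hm₁ y hyT _ h.missing)
  · obtain ⟨g, hge, hpg, hgb⟩ := exists_of_not_missing (hbm p hp)
    refine ⟨g, hge, hpg, ?_, fun hh => hb g hge hh hgb⟩
    rw [hS₂.swap_of_notMem hge hpg (hu p hp hpu), hφ₁T g hge p hp hpg, hgb]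

/-- After the recolouring, `b` is missing at `u`, so it must lie on an edge joining the other two
vertices of the triangle; but there it is on edges that leave the triangle. -/
theorem not_isTwoFan [Finite N] (H : IsCriticalBounded ends k D W)
    (hx : ∀ v, (edgesAt ends v).card ≤ (edgesAt ends x).card) :
    ¬ IsTwoFan ends φ e f x y z := by
  intro h
  obtain ⟨b, hb⟩ := H.exists_outer_color hx h
  obtain ⟨ψ, hψ, u, hu, hm, hp⟩ := H.exists_recolouring hx h hb
  have hxy := H.ne_of_ends h.ends_left
  have hxz := H.ne_of_ends h.ends_right
  simp only [Set.mem_insert_iff, Set.mem_singleton_iff] at hu hp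
  rcases hu with rfl | rfl | rfl
  · obtain ⟨g, hge, hyg, rfl, hout⟩ := hp y (by simp) hxy.symm
    obtain ⟨g', hge', hg', hgg'⟩ := H.exists_edge_of_missing hx hψ hm
    have : g' = g := by
      by_contra hne
      exact hψ.proper g' g hge' hge hne y (by rw [hg']; simp) hyg hgg'
    subst this
    refine hout fun v hv => ?_
    rw [hg', Sym2.mem_iff] at hv
    tauto
  · obtain ⟨g, hge, hxg, rfl, hout⟩ := hp x (by simp) hxy
    have hg := H.ends_of_missing_left hx hψ hge hxg hm
    refine hout fun v hv => ?_
    rw [hg, Sym2.mem_iff] at hv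
    tauto
  · obtain ⟨g, hge, hxg, rfl, hout⟩ := hp x (by simp) hxz
    have hg := H.ends_of_missing_right hx hψ hge hxg hm
    refine hout fun v hv => ?_
    rw [hg, Sym2.mem_iff] at hv
    tauto

/-- A fan with two leaves always exists: a colour missing at `y` occurs at `x`, on an edge whose
other end is not `y`. -/
theorem false [Finite N] (H : IsCriticalBounded ends k D W) : False := by
  obtain ⟨e₀⟩ := H.nonempty
  obtain ⟨v₀, hv₀⟩ : ∃ v, v ∈ ends e₀ := ⟨(ends e₀).out.1, Sym2.out_fst_mem _⟩
  have : Nonempty N := ⟨v₀⟩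
  obtain ⟨x, hx⟩ := Finite.exists_max fun v => (edgesAt ends v).card
  obtain ⟨e, he⟩ := Finset.card_pos.1
    ((Finset.card_pos.2 ⟨e₀, mem_edgesAt.2 hv₀⟩).trans_le (hx v₀))
  obtain ⟨y, hy⟩ := mem_edgesAt.1 he
  obtain ⟨φ, hφ⟩ := H.exists_colouring e
  obtain ⟨c, hc⟩ := H.exists_missing hx e φ y
  obtain ⟨f, hfe, ⟨z, hz⟩, rfl⟩ := exists_of_not_missing (ends := ends) (e := e) (φ := φ) (v := x)
    (fun hxc => H.not_missing_ends hy hφ hxc hc)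
  refine H.not_isTwoFan hx (φ := φ) ⟨hφ, hy, hz, ?_, hc⟩
  rintro rfl
  exact hc f hfe (by rw [hz]; simp) rfl

end IsCriticalBounded

end Critical

/-! ### From line graphs to critical multigraphs -/

section Interface

theorem card_le_deg_of_isClique {V : Type*} [Finite V] {L : SimpleGraph V} {K : Finset V}
    (hK : L.IsClique (K : Set V)) {f : V} (hf : f ∈ K) : K.card ≤ deg L f + 1 := by
  classical
  have h : ((K.erase f : Finset V) : Set V) ⊆ L.neighborSet f := by
    intro g hg
    rw [Finset.mem_coe, Finset.mem_erase] at hg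
    exact hK (Finset.mem_coe.2 hf) (Finset.mem_coe.2 hg.2) hg.1.symm
  have h1 := Set.ncard_le_ncard h (Set.toFinite _)
  rw [Set.ncard_coe_finset, Finset.card_erase_of_mem hf] at h1
  unfold deg
  omega

theorem card_le_localCliqueNum {V : Type*} [Finite V] {L : SimpleGraph V} {K : Finset V}
    (hK : L.IsClique (K : Set V)) {f : V} (hf : f ∈ K) : K.card ≤ localCliqueNum L f :=
  (isGreatest_localCliqueNum L f).2 ⟨K, hK, hf, rfl⟩

/-- The sum form of a bound on the averages. -/
theorem sum_le_of_cliqueAverage_le {V : Type*} {L : SimpleGraph V} {X : Finset V}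
    (hX : X.Nonempty) {k : ℕ} (h : cliqueAverage L X ≤ k) :
    ∑ v ∈ X, (deg L v + 1 + localCliqueNum L v) ≤ 2 * X.card * k := by
  have hpos : (0 : ℝ) < X.card := by exact_mod_cast hX.card_pos
  unfold cliqueAverage at h
  rw [one_div, inv_mul_le_iff₀ hpos, ← Finset.sum_div, div_le_iff₀ (by norm_num)] at h
  have : ((∑ v ∈ X, (deg L v + 1 + localCliqueNum L v) : ℕ) : ℝ) ≤ ((2 * X.card * k : ℕ) : ℝ) := by
    push_cast
    calc _ = ∑ v ∈ X, ((deg L v : ℝ) + localCliqueNum L v + 1) :=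
          Finset.sum_congr rfl fun v _ => by ring
      _ ≤ _ := h
      _ = _ := by ring
  exact_mod_cast this

theorem isCriticalBounded_of_average {E N : Type*} [Fintype E] {L : SimpleGraph E}
    {ends : E → Sym2 N} (hl : ∀ f, ¬ (ends f).IsDiag)
    (hLadj : ∀ f g, L.Adj f g ↔ f ≠ g ∧ ∃ v, v ∈ ends f ∧ v ∈ ends g) {k : ℕ}
    (havg : ∀ X ∈ cliqueFamily 3 L, cliqueAverage L X ≤ k) (hL : ¬ L.Colorable k)
    (hcrit : ∀ e, (L.induce {f | f ≠ e}).Colorable k) :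
    IsCriticalBounded ends k (fun f => deg L f + 1) (localCliqueNum L) := by
  classical
  have hclique : ∀ K : Finset E, (∀ f ∈ K, ∀ g ∈ K, f ≠ g → ∃ v, v ∈ ends f ∧ v ∈ ends g) →
      L.IsClique (K : Set E) := fun K hK f hf g hg hfg => (hLadj f g).2 ⟨hfg, hK f hf g hg hfg⟩
  have hsum3 : ∀ f g h : E, f ≠ g → f ≠ h → g ≠ h → L.Adj f g → L.Adj f h → L.Adj g h →
      L.IsClique (({f, g, h} : Finset E) : Set E) ∧ deg L f + 1 + localCliqueNum L f +
        (deg L g + 1 + localCliqueNum L g) + (deg L h + 1 + localCliqueNum L h) ≤ 6 * k := by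
    intro f g h hfg hfh hgh afg afh agh
    have hcard : ({f, g, h} : Finset E).card = 3 := Finset.card_eq_three.2 ⟨f, g, h, hfg, hfh, hgh, rfl⟩
    have hc : L.IsClique (({f, g, h} : Finset E) : Set E) := by
      have := (SimpleGraph.is3Clique_triple_iff (G := L)).2 ⟨afg, afh, agh⟩
      exact this.isClique
    refine ⟨hc, ?_⟩
    have h1 := sum_le_of_cliqueAverage_le (by simp) (havg {f, g, h} (Or.inr ⟨hc, by rw [hcard]; rfl⟩))
    rw [hcard, Finset.sum_insert (by simp [hfg, hfh]), Finset.sum_pair hgh] at h1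
    omega
  have hpos : 0 < k := by
    rcases isEmpty_or_nonempty E with _ | ⟨⟨s⟩⟩
    · exact absurd (SimpleGraph.Colorable.of_isEmpty k) hL
    · obtain ⟨X, hX⟩ := cliqueFamily_nonempty 3 L
      have hne : X.Nonempty := by
        rw [Finset.nonempty_iff_ne_empty]
        rintro rfl
        rcases hX with ⟨hX, -⟩ | ⟨-, hX⟩
        · have := hX.le_of_ge (y := {s}) (by simp) (by simp)
          simp at this
        · simp at hX
      have h1 := sum_le_of_cliqueAverage_le hne (havg X hX)
      have h2 : 0 < ∑ v ∈ X, (deg L v + 1 + localCliqueNum L v) :=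
        Finset.sum_pos (fun v _ => by omega) hne
      by_contra h0
      obtain rfl : k = 0 := by omega
      omega
  refine ⟨hl, ?_, ?_, ?_, ?_, hpos, ?_, ?_⟩
  · rintro ⟨ψ, hψ⟩
    refine hL ⟨SimpleGraph.Coloring.mk ψ ?_⟩
    intro a b hab
    obtain ⟨hne, v, hva, hvb⟩ := (hLadj a b).1 hab
    exact hψ a b hne v hva hvb
  · intro e
    obtain ⟨χ⟩ := hcrit e
    -- The colour given to `e` is arbitrary; it is never inspected.
    refine ⟨fun f => if h : f ≠ e then χ ⟨f, h⟩ else ⟨0, hpos⟩, ?_⟩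
    intro f g hf hg hfg v hvf hvg
    simp only [dif_pos hf, dif_pos hg]
    exact χ.valid ((hLadj f g).2 ⟨hfg, v, hvf, hvg⟩)
  · intro f u v hf
    have huv : u ≠ v := by
      rintro rfl
      exact hl f (by rw [hf]; simp)
    have h1 := Finset.card_union_add_card_inter (edgesAt ends u)
      (edgesAt ends v)
    have h2 : edgesAt ends u ∩ edgesAt ends v ⊆
        edgesBetween ends u v := by
      intro g hg
      rw [Finset.mem_inter, mem_edgesAt, mem_edgesAt] at hg
      exact mem_edgesBetween.2 ((Sym2.mem_and_mem_iff huv).1 hg)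
    have h3 : ((edgesAt ends u ∪ edgesAt ends v : Finset E) :
        Set E) ⊆ insert f (L.neighborSet f) := by
      intro g hg
      rw [Finset.mem_coe, Finset.mem_union, mem_edgesAt, mem_edgesAt] at hg
      rw [Set.mem_insert_iff]
      by_cases hgf : g = f
      · exact Or.inl hgf
      · refine Or.inr ((hLadj f g).2 ⟨Ne.symm hgf, ?_⟩)
        rcases hg with hg | hg
        · exact ⟨u, by rw [hf]; simp, hg⟩
        · exact ⟨v, by rw [hf]; simp, hg⟩
    have h4 := Set.ncard_le_ncard h3 (Set.toFinite _)
    rw [Set.ncard_coe_finset] at h4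
    have h5 := Set.ncard_insert_le f (L.neighborSet f)
    have h6 := Finset.card_le_card h2
    change _ ≤ (L.neighborSet f).ncard + 1 + _
    omega
  · intro K hK f hf
    exact card_le_localCliqueNum (hclique K hK) hf
  · intro f g hfg hv
    have hfgadj := (hLadj f g).2 ⟨hfg, hv⟩
    have hc : L.IsClique (({f, g} : Finset E) : Set E) := by
      rw [Finset.coe_pair, SimpleGraph.isClique_pair]
      exact fun _ => hfgadj
    by_cases hm : Maximal L.IsClique (({f, g} : Finset E) : Set E)
    · right
      have h1 := sum_le_of_cliqueAverage_le (by simp) (havg {f, g} (Or.inl ⟨hm, by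
        rw [Finset.card_pair hfg]; norm_num⟩))
      rw [Finset.card_pair hfg, Finset.sum_pair hfg] at h1
      omega
    -- A non-maximal pair lies in a triangle, whose edges all have `D, W ≥ 3`; thus `18 ≤ 6k`.
    · left
      rw [maximal_iff_forall_gt] at hm
      push Not at hm
      obtain ⟨Y, hY, hYc⟩ := hm hc
      obtain ⟨hsub, h, hhY, hh⟩ := Set.ssubset_iff_exists.1 hY
      rw [Finset.mem_coe, Finset.mem_insert, Finset.mem_singleton] at hh
      push Not at hh
      have hfY : f ∈ Y := hsub (by simp)
      have hgY : g ∈ Y := hsub (by simp)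
      obtain ⟨h3, h4⟩ := hsum3 f g h hfg hh.1.symm hh.2.symm hfgadj
        (hYc hfY hhY hh.1.symm) (hYc hgY hhY hh.2.symm)
      have hcard : ({f, g, h} : Finset E).card = 3 :=
        Finset.card_eq_three.2 ⟨f, g, h, hfg, hh.1.symm, hh.2.symm, rfl⟩
      have a1 := card_le_deg_of_isClique h3 (f := f) (by simp)
      have a2 := card_le_deg_of_isClique h3 (f := g) (by simp)
      have a3 := card_le_deg_of_isClique h3 (f := h) (by simp)
      have b1 := card_le_localCliqueNum h3 (f := f) (by simp)
      have b2 := card_le_localCliqueNum h3 (f := g) (by simp)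
      have b3 := card_le_localCliqueNum h3 (f := h) (by simp)
      omega
  · intro f g h hfg hfh hgh v1 v2 v3
    exact (hsum3 f g h hfg hfh hgh ((hLadj _ _).2 ⟨hfg, v1⟩) ((hLadj _ _).2 ⟨hfh, v2⟩)
      ((hLadj _ _).2 ⟨hgh, v3⟩)).2

theorem colorable_of_ends {V N : Type*} [Finite V] [Finite N] {Q : SimpleGraph V} {ends : V → Sym2 N}
    (hl : ∀ f, ¬ (ends f).IsDiag)
    (hadj : ∀ f g, Q.Adj f g ↔ f ≠ g ∧ ∃ v, v ∈ ends f ∧ v ∈ ends g) :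
    Q.Colorable ⌈gammaTilde 3 Q⌉₊ := by
  by_contra hQ
  set k := ⌈gammaTilde 3 Q⌉₊
  -- Since `γ̃₃` ranges over all subgraphs, the bound on averages passes to the critical subgraph
  -- induced by `S`.
  obtain ⟨S, hS⟩ := (Set.toFinite {S : Set V | ¬ (Q.induce S).Colorable k}).exists_minimal
    ⟨Set.univ, fun h => hQ (h.of_hom Q.induceUnivIso.symm.toHom)⟩
  let H : Q.Subgraph := (⊤ : Q.Subgraph).induce S
  have := Fintype.ofFinite H.verts
  have hHadj : ∀ f g : H.verts, H.coe.Adj f g ↔ Q.Adj f g := fun f g =>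
    ⟨fun h => h.2.2, fun h => ⟨f.2, g.2, h⟩⟩
  refine (isCriticalBounded_of_average (L := H.coe) (ends := fun f : H.verts => ends f) (k := k)
    (fun f => hl f) (fun f g => ?_) (fun X hX => ?_) (fun ⟨χ⟩ => hS.prop ?_) fun e => ?_).false
  · rw [hHadj, hadj, Ne, Ne, Subtype.ext_iff]
  · exact ((isGreatest_gamma 3 H.coe).2 ⟨X, hX, rfl⟩).trans
      (((isGreatest_gammaTilde 3 Q).2 ⟨H, rfl⟩).trans (Nat.le_ceil _))
  · exact ⟨SimpleGraph.Coloring.mk (fun v : S => χ ⟨v, v.2⟩) fun {a b} hab =>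
      χ.valid ((hHadj ⟨a, a.2⟩ ⟨b, b.2⟩).2 hab)⟩
  · have hlt : S \ {(e : V)} < S := ⟨fun _ h => h.1, fun hh => (hh e.2).2 rfl⟩
    obtain ⟨χ⟩ := not_not.1 (hS.not_prop_of_lt hlt)
    exact ⟨SimpleGraph.Coloring.mk
      (fun v : {f : H.verts | f ≠ e} => χ ⟨v, v.1.2, fun hh => v.2 (Subtype.ext hh)⟩)
      fun {a b} hab => χ.valid ((hHadj a b).1 hab)⟩

/-- A line graph is described by the pairs of ends of the edges. -/
theorem IsLineGraph.exists_ends.{u} {V : Type u} {Q : SimpleGraph V} (hQ : IsLineGraph Q) :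
    ∃ (N : Type u) (_ : Finite N) (ends : V → Sym2 N), (∀ f, ¬ (ends f).IsDiag) ∧
      ∀ f g, Q.Adj f g ↔ f ≠ g ∧ ∃ v, v ∈ ends f ∧ v ∈ ends g := by
  obtain ⟨α, β, G, hG, hV, -, ⟨i⟩⟩ := hQ
  have hex : ∀ v : V, ∃ x y, G.IsLink (i v) x y := fun v => G.exists_isLink_of_mem_edgeSet (i v).2
  choose X Y hXY using hex
  -- Ends are taken in the vertex set and not in `α`, which may be infinite.
  let ends : V → Sym2 G.vertexSet := fun v => s(⟨X v, (hXY v).left_mem⟩, ⟨Y v, (hXY v).right_mem⟩)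
  have hinc : ∀ v (x : G.vertexSet), x ∈ ends v ↔ G.Inc (i v) x := by
    intro v x
    simp only [ends, Sym2.mem_iff, Subtype.ext_iff]
    constructor
    · rintro (h | h)
      · rw [h]
        exact (hXY v).inc_left
      · rw [h]
        exact (hXY v).inc_right
    · intro h
      exact h.eq_or_eq_of_isLink (hXY v)
  refine ⟨G.vertexSet, hV, ends, fun v hv => ?_, fun f g => ?_⟩
  · rw [Sym2.mk_isDiag_iff, Subtype.mk.injEq] at hv
    have := hXY v
    rw [hv] at this
    exact hG.not_isLoopAt _ _ this
  · rw [← i.map_adj_iff]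
    constructor
    · rintro ⟨hne, x, hf, hg⟩
      refine ⟨fun hh => hne (by rw [hh]), ⟨x, hf.vertex_mem⟩, (hinc _ _).2 hf, (hinc _ _).2 hg⟩
    · rintro ⟨hne, x, hf, hg⟩
      exact ⟨fun hh => hne (i.injective hh), x, (hinc _ _).1 hf, (hinc _ _).1 hg⟩

end Interface

end LocalReed

/-- The averages are nonnegative, so the natural-number ceiling is the usual one. -/
theorem mainTheorem7 {V : Type*} [Finite V] (Q : SimpleGraph V)
    (hQ : LocalReed.IsLineGraph Q) :
    Q.chromaticNumber ≤ ((⌈LocalReed.gammaTilde 3 Q⌉₊ : ℕ) : ℕ∞) := by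
  obtain ⟨N, _, ends, hl, hadj⟩ := hQ.exists_ends
  exact (LocalReed.colorable_of_ends hl hadj).chromaticNumber_le
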